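/- **Theorem 1.** Let $k\ge 3$, let $\mathbb B$ be a $k$-neoliberal relational structure with finite duality, and let $\mathbb A$ be a first-order expansion of $\mathbb B$ with bounded strict width. Then $\mathbb A$ is implicationally simple on injective instances, i.e. its $k$-ary injective implication graph has no directed cycle. The notions are as follows. *Neoliberal structures.* A permutation group $G$ on a set $A$ is $k$-neoliberal if: it has finitely many orbits of $n$-tuples for every $n$; it acts transitively on injective $(k-1)$-tuples; for every $\ell\ge k$ the orbit of an $\ell$-tuple is determined by the orbits of its $k$-subtuples; and for any $k-1$ distinct elements, their pointwise stabilizer fixes no other element. $\mathbb B$ is $k$-neoliberal if it is the canonical $k$-ary structure of such a $G$: the structure on $A$ whose relations are the orbits of injective $k$-tuples under $G$. *Finite duality.* There is a finite set $\mathcal F$ of finite structures in the signature of $\mathbb B$ such that a finite structure $\mathbb C$ in that signature has a homomorphism to $\mathbb B$ if and only if no $\mathbb F\in\mathcal F$ has a homomorphism to $\mathbb C$. *First-order expansion.* $\mathbb A$ is a relational structure on the same set $A$ that has all relations of $\mathbb B$ among its relations, and all of whose relations are first-order definable in $\mathbb B$ without parameters. *Bounded strict width.* A pp-formula is one built from atomic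 formulas (equalities included) by conjunction and existential quantification. A constraint over a finite set $V$ of variables is a set $C\subseteq A^U$ with $\emptyset\ne U\subseteq V$ (its scope); an instance over a set of relations is a finite set of constraints, each given by a relation $R$ of the set and an enumeration of its scope (possibly with repetitions) as $\{f\in A^U: (f(u_1),\dots,f(u_n))\in R\}$. A solution is a map $V\to A$ whose restriction to the scope of every constraint lies in the constraint. An instance is $(m,\ell)$-minimal if every tuple of at most $\ell$ variables lies in the scope of some constraint, and for every tuple of at most $m$ variables all constraints whose scopes contain it have the same projection onto it. $\mathbb A$ has strict width $m\ge 1$ if there is $\ell>m$ such that the following holds for every $(m,\ell)$-minimal instance $\mathcal J$ over the relations pp-definable in $\mathbb A$ of arity at most the maximum of $\ell$ and the arities of the relations of $\mathbb A$, provided that $\mathcal J$ has the same variables and the same solutions as some instance over the relations of $\mathbb A$: whenever $U\subseteq V$ and $g\colon U\to A$ is such that for every constraint $C$ of $\mathcal J$ with scope $W$ the map $g|_{U\cap W}$ is the restriction of an element of $C$, then $g$ extends to a solution of $\mathcal J$. $\mathbb A$ has bounded strict width if it has strict width $m$ for some $m\ge 1$. *Injective implication graph.* For a formula $\phi$ with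 variables from $V$ let $\phi^{\mathbb A}\subseteq A^V$ be its set of satisfying assignments, and $\mathrm{proj}_{u}(\phi^{\mathbb A})=\{f(u): f\in\phi^{\mathbb A}\}$ for a tuple $u$ of variables. Let $u,v$ be injective tuples of variables of lengths $p,q<|V|$ that together contain every element of $V$, and let $C\subseteq A^{p}$, $D\subseteq A^{q}$ be non-empty and pp-definable in $\mathbb A$. A pp-formula $\phi$ over $\mathbb A$ with variables from $V$ is a $(C,u,D,v)$-implication if: (1) for all distinct $x,y\in V$ some $f\in\phi^{\mathbb A}$ has $f(x)\ne f(y)$; (2) $C\subsetneq \mathrm{proj}_u(\phi^{\mathbb A})$; (3) $D\subsetneq \mathrm{proj}_v(\phi^{\mathbb A})$; (4) for every $f\in\phi^{\mathbb A}$, $f(u)\in C$ implies $f(v)\in D$; (5) for every $a\in D$ there is $f\in\phi^{\mathbb A}$ with $f(u)\in C$ and $f(v)=a$. It is injective if all elements of $\phi^{\mathbb A}$ are injective maps. The vertices of the $k$-ary injective implication graph of $\mathbb A$ are the pairs $(C_1,C)$ with $\emptyset\neq C\subsetneq C_1\subseteq A^k$, both pp-definable in $\mathbb A$, and $C$ consisting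 of injective tuples. There is an arc from $(C_1,C)$ to $(D_1,D)$ if $(C_1,C)\ne(D_1,D)$ and there is an injective $(C,u,D,v)$-implication $\phi$ in $\mathbb A$ with $\mathrm{proj}_u(\phi^{\mathbb A})=C_1$ and $\mathrm{proj}_v(\phi^{\mathbb A})=D_1$. -/

import Mathlib

open scoped FirstOrder

universe u v w

namespace StrictWidth

/-! ### Permutation groups -/

/-- A permutation group `G` on `A` is oligomorphic if for every `n` it has only finitely many
orbits of `n`-tuples. -/
def IsOligomorphic {A : Type u} (G : Subgroup (Equiv.Perm A)) : Prop :=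
  ∀ n : ℕ, Finite (MulAction.orbitRel.Quotient G (Fin n → A))

/-- `G` is `k`-homogeneous if for every `ℓ ≥ k`, the orbit of an `ℓ`-tuple is determined by the
orbits of its `k`-subtuples. -/
def IsKHomogeneous {A : Type u} (G : Subgroup (Equiv.Perm A)) (k : ℕ) : Prop :=
  ∀ ℓ : ℕ, k ≤ ℓ → ∀ a b : Fin ℓ → A,
    (∀ s : Fin k ↪o Fin ℓ, (a ∘ s) ∈ MulAction.orbit G (b ∘ s)) → a ∈ MulAction.orbit G b

/-- `G` has no `k`-algebraicity if the pointwise stabilizer of any `k - 1` elements fixes no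
further elements. It is only used for `k ≥ 1`. -/
def HasNoKAlgebraicity {A : Type u} (G : Subgroup (Equiv.Perm A)) (k : ℕ) : Prop :=
  ∀ a : Fin (k - 1) ↪ A, ∀ x : A,
    (∀ g ∈ G, (∀ i, g (a i) = a i) → g x = x) → x ∈ Set.range a

/-- `k`-neoliberal permutation groups. -/
structure IsNeoliberal {A : Type u} (G : Subgroup (Equiv.Perm A)) (k : ℕ) : Prop where
  oligomorphic : IsOligomorphic G
  transitive : MulAction.IsMultiplyPretransitive G A (k - 1)
  homogeneous : IsKHomogeneous G k
  no_algebraicity : HasNoKAlgebraicity G k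

/-! ### The canonical `k`-ary structure -/

/-- The signature with one `k`-ary relation symbol for every orbit of injective `k`-tuples
under `G`, and no other symbols. -/
def canonicalLanguage {A : Type u} (G : Subgroup (Equiv.Perm A)) (k : ℕ) :
    FirstOrder.Language.{0, u} where
  Functions := fun _ => Empty
  Relations := fun n => {O : Set (Fin n → A) //
    n = k ∧ ∃ a : Fin n → A, Function.Injective a ∧ O = MulAction.orbit G a}

/-- The canonical `k`-ary structure of `G`: every orbit is interpreted by itself. -/
instance canonicalStructure {A : Type u} (G : Subgroup (Equiv.Perm A)) (k : ℕ) :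
    (canonicalLanguage G k).Structure A where
  funMap := fun f _ => nomatch f
  RelMap := fun R x => x ∈ R.1

/-! ### Finite duality and first-order expansions -/

/-- `B` has finite duality: there is a finite set `F` of finite structures such that a finite
structure maps homomorphically to `B` if and only if no member of `F` maps homomorphically
to it. -/
def HasFiniteDuality (L : FirstOrder.Language.{v, w}) (B : Type u) [L.Structure B] : Prop :=
  ∃ F : Set (CategoryTheory.Bundled.{0} L.Structure), F.Finite ∧ (∀ S ∈ F, Finite S) ∧
    ∀ C : CategoryTheory.Bundled.{0} L.Structure, Finite C →
      (Nonempty (C →[L] B) ↔ ∀ S ∈ F, IsEmpty (S →[L] C))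

/-- The `L`-structure on `A` is a first-order expansion of the `L₀`-structure on `A`: every symbol
of `L₀` is (via a map of signatures) a symbol of `L` with the same interpretation, and every
relation of the `L`-structure is first-order definable without parameters in the
`L₀`-structure. -/
def IsFirstOrderExpansion (L₀ : FirstOrder.Language.{0, u}) (L : FirstOrder.Language.{v, w})
    (A : Type u) [L₀.Structure A] [L.Structure A] : Prop :=
  (∃ θ : L₀ →ᴸ L, θ.IsExpansionOn A) ∧
    ∀ (n : ℕ) (R : L.Relations n),
      (∅ : Set A).Definable L₀ {x : Fin n → A | FirstOrder.Language.Structure.RelMap R x}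

/-! ### Primitive positive formulas -/

/-- Primitive positive formulas: built from atomic formulas (equalities included) by conjunction
and existential quantification. -/
inductive IsPP {L : FirstOrder.Language.{v, w}} {α : Type} : ∀ {n : ℕ}, L.BoundedFormula α n → Prop
  | atomic {n : ℕ} {φ : L.BoundedFormula α n} : φ.IsAtomic → IsPP φ
  | inf {n : ℕ} {φ ψ : L.BoundedFormula α n} : IsPP φ → IsPP ψ → IsPP (φ ⊓ ψ)
  | ex {n : ℕ} {φ : L.BoundedFormula α (n + 1)} : IsPP φ → IsPP φ.ex

/-- The set of satisfying assignments of a formula with free variables from `V`. -/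
def sols {L : FirstOrder.Language.{v, w}} (A : Type u) [L.Structure A] {V : Type} (φ : L.Formula V) :
    Set (V → A) :=
  {f | φ.Realize f}

/-- A relation is pp-definable if it is the set of satisfying assignments of a pp-formula. -/
def PPDefinable (L : FirstOrder.Language.{v, w}) {A : Type u} [L.Structure A] {n : ℕ}
    (S : Set (Fin n → A)) : Prop :=
  ∃ φ : L.Formula (Fin n), IsPP φ ∧ S = sols A φ

/-- The projection of a set of assignments to a tuple of variables. -/
def proj {A : Type u} {V : Type} {n : ℕ} (t : Fin n → V) (S : Set (V → A)) : Set (Fin n → A) :=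
  {a | ∃ f ∈ S, f ∘ t = a}

/-! ### Instances of constraint satisfaction problems -/

/-- A constraint over the variables `V` and the domain `A`: a scope `U ⊆ V` and a subset
of `A ^ U`. -/
structure Constraint (V : Type) (A : Type u) where
  scope : Set V
  rel : Set (scope → A)

/-- A finite set of constraints is an instance over the family `Γ` of relations if every constraint
has non-empty scope and is obtained from some relation in `Γ` by enumerating the scope
(an element may be listed more than once, as in `R(x, x, y)`). -/
def IsInstance {V : Type} {A : Type u} (Γ : ∀ n : ℕ, Set (Set (Fin n → A)))
    (I : Set (Constraint V A)) : Prop :=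
  I.Finite ∧ ∀ c ∈ I, c.scope.Nonempty ∧
    ∃ (n : ℕ) (e : Fin n → c.scope) (R : Set (Fin n → A)),
      Function.Surjective e ∧ R ∈ Γ n ∧ c.rel = {f | f ∘ e ∈ R}

/-- Solutions of an instance. -/
def IsSolution {V : Type} {A : Type u} (I : Set (Constraint V A)) (f : V → A) : Prop :=
  ∀ c ∈ I, (fun x : c.scope => f x) ∈ c.rel

/-- The projection of a constraint to a tuple of variables from its scope. -/
def Constraint.proj {V : Type} {A : Type u} (c : Constraint V A) {m : ℕ} (t : Fin m → V) :
    Set (Fin m → A) :=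
  {a | ∃ f ∈ c.rel, ∀ i, ∃ h : t i ∈ c.scope, f ⟨t i, h⟩ = a i}

/-- `(k, ℓ)`-minimal instances. -/
def IsMinimalInstance {V : Type} {A : Type u} (k ℓ : ℕ) (I : Set (Constraint V A)) : Prop :=
  (∀ m : ℕ, 1 ≤ m → m ≤ ℓ → ∀ t : Fin m → V, ∃ c ∈ I, Set.range t ⊆ c.scope) ∧
  (∀ m : ℕ, 1 ≤ m → m ≤ k → ∀ t : Fin m → V, ∀ c₁ ∈ I, ∀ c₂ ∈ I,
    Set.range t ⊆ c₁.scope → Set.range t ⊆ c₂.scope → c₁.proj t = c₂.proj t)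

/-- The partial assignment `g` on `U` is consistent with every constraint of the instance: for
every constraint, the restriction of `g` to the part of `U` in the scope extends to an element of
the constraint. -/
def IsPartialSolution {V : Type} {A : Type u} (I : Set (Constraint V A)) (U : Set V)
    (g : U → A) : Prop :=
  ∀ c ∈ I, ∃ f ∈ c.rel, ∀ (x : V) (hU : x ∈ U) (hc : x ∈ c.scope), f ⟨x, hc⟩ = g ⟨x, hU⟩

/-- The relations of the structure on `A`. -/
def basicRelations (L : FirstOrder.Language.{v, w}) (A : Type u) [L.Structure A] (n : ℕ) :
    Set (Set (Fin n → A)) :=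
  {S | ∃ R : L.Relations n, S = {x | FirstOrder.Language.Structure.RelMap R x}}

/-- The relations pp-definable in the structure on `A` of arity at most `p`, where `p` is
the maximum of `ℓ` and of the arities of the relations of the structure. -/
def ppRelations (L : FirstOrder.Language.{v, w}) (A : Type u) [L.Structure A] (ℓ n : ℕ) :
    Set (Set (Fin n → A)) :=
  {S | PPDefinable L S ∧ (n ≤ ℓ ∨ ∃ m : ℕ, n ≤ m ∧ Nonempty (L.Relations m))}

/-- Strict width `k`: there is `ℓ > k` such that in every `(k, ℓ)`-minimal instance which is
equivalent to an instance of the constraint satisfaction problem of the structure on `A`, every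
consistent partial assignment extends to a solution. The minimal instances use the relations
pp-definable in the structure of arity at most the maximum of `ℓ` and the arities of the
structure; equivalent means having the same variables and the same solutions. -/
def HasStrictWidth (L : FirstOrder.Language.{v, w}) (A : Type u) [L.Structure A] (k : ℕ) : Prop :=
  1 ≤ k ∧ ∃ ℓ : ℕ, k < ℓ ∧ ∀ (V : Type) [Finite V] (I J : Set (Constraint V A)),
    IsInstance (basicRelations L A) I →
    IsInstance (ppRelations L A ℓ) J →
    (∀ f : V → A, IsSolution J f ↔ IsSolution I f) →
    IsMinimalInstance k ℓ J →
    ∀ (U : Set V) (g : U → A), IsPartialSolution J U g →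
      ∃ f : V → A, IsSolution J f ∧ ∀ x : U, f x = g x

/-- Bounded strict width. -/
def HasBoundedStrictWidth (L : FirstOrder.Language.{v, w}) (A : Type u) [L.Structure A] : Prop :=
  ∃ k : ℕ, HasStrictWidth L A k

/-! ### Implications and the injective implication graph -/

/-- `φ` is a `(C, u, D, v)`-implication in the structure on `A`. -/
structure IsImplication {L : FirstOrder.Language.{v, w}} {A : Type u} [L.Structure A] {V : Type} {k m : ℕ}
    (φ : L.Formula V) (C : Set (Fin k → A)) (u : Fin k → V)
    (D : Set (Fin m → A)) (v : Fin m → V) : Prop where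
  pp : IsPP φ
  left_injective : Function.Injective u
  right_injective : Function.Injective v
  left_lt : k < Nat.card V
  right_lt : m < Nat.card V
  cover : Set.range u ∪ Set.range v = Set.univ
  left_pp : PPDefinable L C
  right_pp : PPDefinable L D
  left_nonempty : C.Nonempty
  right_nonempty : D.Nonempty
  not_forced_eq : ∀ x y : V, x ≠ y → ∃ f ∈ sols A φ, f x ≠ f y
  left_ssubset : C ⊂ proj u (sols A φ)
  right_ssubset : D ⊂ proj v (sols A φ)
  imp : ∀ f ∈ sols A φ, f ∘ u ∈ C → f ∘ v ∈ D
  surj : ∀ a ∈ D, ∃ f ∈ sols A φ, f ∘ u ∈ C ∧ f ∘ v = a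

/-- The vertices of the `k`-ary injective implication graph: pairs `(C₁, C)` of pp-definable
`k`-ary relations such that `C` is a non-empty proper subset of `C₁` all of whose
elements are injective tuples. -/
structure InjVertex (L : FirstOrder.Language.{v, w}) (A : Type u) [L.Structure A] (k : ℕ) where
  outer : Set (Fin k → A)
  inner : Set (Fin k → A)
  nonempty : inner.Nonempty
  ssubset : inner ⊂ outer
  outer_pp : PPDefinable L outer
  inner_pp : PPDefinable L inner
  inner_injective : ∀ a ∈ inner, Function.Injective a

/-- The `k`-ary injective implication graph: there is an arc from `(C₁, C)` to a different vertex
`(D₁, D)` if there is an injective `(C, u, D, v)`-implication (all of whose satisfying assignments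
are injective) with projections `C₁` and `D₁` to `u` and `v`. -/
def injImplicationGraph (L : FirstOrder.Language.{v, w}) (A : Type u) [L.Structure A] (k : ℕ) :
    Digraph (InjVertex L A k) where
  Adj P Q := P ≠ Q ∧ ∃ (V : Type) (φ : L.Formula V) (x y : Fin k → V),
    IsImplication φ P.inner x Q.inner y ∧
    (∀ f ∈ sols A φ, Function.Injective f) ∧
    proj x (sols A φ) = P.outer ∧ proj y (sols A φ) = Q.outer

/-- A digraph is acyclic if it has no directed cycle. -/
def IsAcyclicDigraph {V : Type*} (G : Digraph V) : Prop :=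
  ∀ x : V, ¬ Relation.TransGen G.Adj x x

/-- The structure on `A` is implicationally simple on injective instances (for arity `k`). -/
def IsImplicationallySimpleOnInjective (L : FirstOrder.Language.{v, w}) (A : Type u) [L.Structure A]
    (k : ℕ) : Prop :=
  IsAcyclicDigraph (injImplicationGraph L A k)

end StrictWidth

/-! A directed cycle gives a periodic sequence of injective implications. Followed forwards, tuples
of the inner relations stay in inner relations; followed backwards, tuples of outer minus inner stay
outside the inner ones. As there are finitely many orbits of `k`-tuples, there are paths, periodic
up to `G`, that start in an orbit O inside the inner relation C and in an orbit P outside C.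
Solutions are injective, so which positions consecutive tuples share depends only on the
implications. Over a suitable period the positions that survive form the identity on a set S, and S
misses some position p because every implication has a variable on the right that does not occur on
the left.

Finite duality makes these paths flexible (`exists_smul_chain`): after enough periods the two ends
interact only through S. Hence any two tuples of O, or any two of P, that differ only at p are
joined by a path of implications.

Bounded strict width provides local near-unanimity operations F of some arity n
(`exists_nearUnanimity`, `exists_family`). Apply F to n rows. If the result lies in C, it still does
after entries at p are changed inside the orbits O or P of their rows, since F preserves each
implication on the way. For q ≠ p, entry q of a single row may be changed at will while the other
rows agree at q, because F ignores it. Start with n copies of a in O, where F returns a. By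
(k-1)-transitivity some b in P differs from a only at p, and alternating the two moves
(`exists_zigzag`) turns one row after another into b. In the end F returns b, so b lies in C, a
contradiction (`false_of_periodic_implications`). -/

namespace StrictWidth

open FirstOrder FirstOrder.Language

/-! ### Local near-unanimity operations from bounded strict width -/

/-- The operation `f` preserves the relation symbols in `Rs` on columns taken from `X`. -/
def PreservesSymbols {L : FirstOrder.Language.{v, w}} {A : Type u} [L.Structure A]
    (Rs : Set (Σ n, L.Relations n)) {n : ℕ} (X : Set (Fin n → A)) (f : (Fin n → A) → A) : Prop :=
  ∀ R ∈ Rs, ∀ t : Fin R.1 → (Fin n → A), (∀ i, t i ∈ X) →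
    (∀ r, Structure.RelMap R.2 (fun i => t i r)) → Structure.RelMap R.2 (fun i => f (t i))

theorem PreservesSymbols.mono {L : FirstOrder.Language.{v, w}} {A : Type u} [L.Structure A]
    {Rs Rs' : Set (Σ n, L.Relations n)} {n : ℕ} {X X' : Set (Fin n → A)} {f : (Fin n → A) → A}
    (hf : PreservesSymbols Rs' X' f) (hR : Rs ⊆ Rs') (hX : X ⊆ X') : PreservesSymbols Rs X f :=
  fun R h t ht hr => hf R (hR h) t (fun i => hX (ht i)) hr

/-- Preservation of a pp-formula on a finite set of columns follows from preservation of finitely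
many relation symbols on a larger finite set of columns. -/
theorem IsPP.exists_preserves {L : FirstOrder.Language.{v, w}} [L.IsRelational] {A : Type u}
    [L.Structure A] [Nonempty A] {α : Type} [Finite α] {m : ℕ} {φ : L.BoundedFormula α m} (h : IsPP φ) :
    ∃ Rs : Set (Σ n, L.Relations n), Rs.Finite ∧ ∀ (n : ℕ) (X : Set (Fin n → A)), X.Finite →
      ∃ X' : Set (Fin n → A), X'.Finite ∧ X ⊆ X' ∧ ∀ f, PreservesSymbols Rs X' f →
        ∀ (v : α → Fin n → A) (xs : Fin m → Fin n → A), (∀ i, v i ∈ X) → (∀ i, xs i ∈ X) →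
          (∀ r, φ.Realize (fun i => v i r) (fun i => xs i r)) →
            φ.Realize (fun i => f (v i)) (fun i => f (xs i)) := by
  induction h with
  | @atomic m φ h =>
    have hvar : ∀ t : L.Term (α ⊕ Fin m), ∃ i, t = Term.var i := by
      intro t
      cases t with
      | var i => exact ⟨i, rfl⟩
      | func f _ => exact isEmptyElim f
    cases h with
    | equal t₁ t₂ =>
      obtain ⟨i, rfl⟩ := hvar t₁
      obtain ⟨j, rfl⟩ := hvar t₂
      refine ⟨∅, Set.finite_empty, fun n X hX => ⟨X, hX, subset_rfl, ?_⟩⟩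
      intro f _ v xs _ _ hr
      simp only [BoundedFormula.realize_bdEqual, Term.realize_var] at hr ⊢
      have key : ∀ i : α ⊕ Fin m, ∀ r, Sum.elim (fun i => v i r) (fun i => xs i r) i
          = Sum.elim v xs i r := by rintro (i | i) r <;> rfl
      have key' : ∀ i : α ⊕ Fin m, Sum.elim (fun i => f (v i)) (fun i => f (xs i)) i
          = f (Sum.elim v xs i) := by rintro (i | i) <;> rfl
      rw [key', key']
      congr 1
      funext r
      rw [← key, ← key]
      exact hr r
    | @rel l R ts =>
      choose g hg using fun i => hvar (ts i)
      refine ⟨{⟨l, R⟩}, Set.finite_singleton _, fun n X hX => ⟨X, hX, subset_rfl, ?_⟩⟩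
      intro f hf v xs hv hxs hr
      have key : ∀ i : α ⊕ Fin m, ∀ r, Sum.elim (fun i => v i r) (fun i => xs i r) i
          = Sum.elim v xs i r := by rintro (i | i) r <;> rfl
      have key' : ∀ i : α ⊕ Fin m, Sum.elim (fun i => f (v i)) (fun i => f (xs i)) i
          = f (Sum.elim v xs i) := by rintro (i | i) <;> rfl
      simp only [BoundedFormula.realize_rel, hg, Term.realize_var, key, key'] at hr ⊢
      refine hf ⟨l, R⟩ rfl (fun i => Sum.elim v xs (g i)) (fun i => ?_) hr
      rcases g i with j | j
      · exact hv j
      · exact hxs j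
  | @inf m φ ψ _ _ ih₁ ih₂ =>
    obtain ⟨R₁, hR₁, h₁⟩ := ih₁
    obtain ⟨R₂, hR₂, h₂⟩ := ih₂
    refine ⟨R₁ ∪ R₂, hR₁.union hR₂, fun n X hX => ?_⟩
    obtain ⟨X₁, f₁, s₁, p₁⟩ := h₁ n X hX
    obtain ⟨X₂, f₂, s₂, p₂⟩ := h₂ n X hX
    refine ⟨X₁ ∪ X₂, f₁.union f₂, s₁.trans Set.subset_union_left, ?_⟩
    intro f hf v xs hv hxs hr
    simp only [BoundedFormula.realize_inf] at hr ⊢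
    exact ⟨p₁ f (hf.mono Set.subset_union_left Set.subset_union_left) v xs hv hxs
      (fun r => (hr r).1), p₂ f (hf.mono Set.subset_union_right Set.subset_union_right) v xs hv hxs
      (fun r => (hr r).2)⟩
  | @ex m φ _ ih =>
    obtain ⟨Rs, hR, h⟩ := ih
    refine ⟨Rs, hR, fun n X hX => ?_⟩
    have hw : ∀ (v : α → Fin n → A) (xs : Fin m → Fin n → A), ∃ w : Fin n → A,
        (∀ r, φ.ex.Realize (fun i => v i r) (fun i => xs i r)) →
          ∀ r, φ.Realize (fun i => v i r) (Fin.snoc (fun i => xs i r) (w r)) := by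
      intro v xs
      by_cases hr : ∀ r, φ.ex.Realize (fun i => v i r) (fun i => xs i r)
      · have hr' := hr
        simp only [BoundedFormula.realize_ex] at hr'
        choose w hw using hr'
        exact ⟨w, fun _ => hw⟩
      · exact ⟨fun _ => Classical.arbitrary A, fun h => absurd h hr⟩
    choose w hw using hw
    -- Only finitely many assignments take their columns in `X`. Adding one column of witnesses for
    -- each keeps the set finite, and the induction hypothesis then covers the quantified variable.
    set X₁ : Set (Fin n → A) := X ∪ (fun p : (α → Fin n → A) × (Fin m → Fin n → A) => w p.1 p.2) ''
      ({v | ∀ i, v i ∈ X} ×ˢ {xs | ∀ i, xs i ∈ X}) with hX₁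
    have fX₁ : X₁.Finite := by
      refine hX.union (Set.Finite.image _ (Set.Finite.prod ?_ ?_))
      · exact Set.Finite.pi' fun _ => hX
      · exact Set.Finite.pi' fun _ => hX
    obtain ⟨X', f', s', p'⟩ := h n X₁ fX₁
    refine ⟨X', f', (Set.subset_union_left.trans s'), ?_⟩
    intro f hf v xs hv hxs hr
    rw [BoundedFormula.realize_ex]
    refine ⟨f (w v xs), ?_⟩
    have := p' f hf v (Fin.snoc xs (w v xs)) (fun i => Or.inl (hv i)) ?_ ?_
    · convert this using 1
      funext i
      refine Fin.lastCases ?_ (fun j => ?_) i <;> simp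
    · intro i
      refine Fin.lastCases ?_ (fun j => ?_) i
      · rw [Fin.snoc_last]
        exact Or.inr ⟨(v, xs), ⟨hv, hxs⟩, rfl⟩
      · rw [Fin.snoc_castSucc]
        exact Or.inl (hxs j)
    · intro r
      convert hw v xs hr r using 1
      funext i
      refine Fin.lastCases ?_ (fun j => ?_) i <;> simp

theorem exists_isPP_forall {L : FirstOrder.Language.{v, w}} {A : Type u} [L.Structure A]
    {α : Type} {m : ℕ} (i₀ : α ⊕ Fin m) {ι : Type*} {I : Set ι} (hI : I.Finite)
    (P : ι → (α → A) → (Fin m → A) → Prop)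
    (h : ∀ i ∈ I, ∃ φ : L.BoundedFormula α m, IsPP φ ∧ ∀ v xs, φ.Realize v xs ↔ P i v xs) :
    ∃ φ : L.BoundedFormula α m, IsPP φ ∧ ∀ v xs, φ.Realize v xs ↔ ∀ i ∈ I, P i v xs := by
  induction I, hI using Set.Finite.induction_on with
  | empty =>
    -- The empty conjunction is written as a trivial equation, since `⊤` is not primitive positive
    -- here; this is why a variable `i₀` is required.
    refine ⟨(Term.var i₀).bdEqual (Term.var i₀), .atomic (.equal _ _), fun v xs => ?_⟩
    simp
  | @insert i I _ _ ih =>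
    obtain ⟨φ, hφ, h₁⟩ := ih fun j hj => h j (Or.inr hj)
    obtain ⟨ψ, hψ, h₂⟩ := h i (Or.inl rfl)
    refine ⟨ψ ⊓ φ, .inf hψ hφ, fun v xs => ?_⟩
    rw [BoundedFormula.realize_inf, h₁, h₂, Set.forall_mem_insert]

theorem IsPP.exs {L : FirstOrder.Language.{v, w}} {α : Type} :
    ∀ {m : ℕ} {φ : L.BoundedFormula α m}, IsPP φ → IsPP φ.exs
  | 0, _, h => h
  | _ + 1, φ, h => IsPP.exs (φ := φ.ex) (IsPP.ex h)

/-- The projection of the solution set of a finite system of atomic conditions is pp-definable. -/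
theorem ppDefinable_projection {L : FirstOrder.Language.{v, w}} {A : Type u} [L.Structure A]
    {N n : ℕ} (hn : 0 < n) {At : Set (Σ R : (Σ l, L.Relations l), Fin R.1 → Fin N)}
    (hAt : At.Finite) (e : Fin n → Fin N) :
    PPDefinable L {z : Fin n → A | ∃ s : Fin N → A,
      (∀ a ∈ At, Structure.RelMap a.1.2 (s ∘ a.2)) ∧ ∀ i, s (e i) = z i} := by
  obtain ⟨φ, hφ, h₁⟩ := exists_isPP_forall (L := L) (A := A) (α := Fin n) (m := N)
    (Sum.inl ⟨0, hn⟩) hAt (fun a _ s => Structure.RelMap a.1.2 (s ∘ a.2)) (by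
      rintro ⟨⟨l, R⟩, t⟩ -
      refine ⟨R.boundedFormula fun i => Term.var (Sum.inr (t i)), .atomic (.rel _ _), fun v xs => ?_⟩
      rw [BoundedFormula.realize_rel]
      rfl)
  obtain ⟨ψ, hψ, h₂⟩ := exists_isPP_forall (L := L) (A := A) (α := Fin n) (m := N)
    (Sum.inl ⟨0, hn⟩) (Set.finite_univ (α := Fin n)) (fun i z s => s (e i) = z i) (by
      rintro i -
      refine ⟨(Term.var (Sum.inr (e i))).bdEqual (Term.var (Sum.inl i)), .atomic (.equal _ _),
        fun v xs => ?_⟩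
      simp)
  refine ⟨(φ ⊓ ψ).exs, (hφ.inf hψ).exs, ?_⟩
  ext z
  change _ ↔ (φ ⊓ ψ).exs.Realize z
  rw [BoundedFormula.realize_exs]
  simp only [BoundedFormula.realize_inf, h₁, h₂, Set.mem_ofPred_eq, Set.mem_univ, true_imp_iff]

/-- Strict width yields local near-unanimity operations: for finitely many relation symbols there
is an arity `n` such that on every finite set of columns some operation preserves the symbols
and satisfies the near-unanimity identities. -/
theorem HasBoundedStrictWidth.exists_nearUnanimity {L : FirstOrder.Language.{v, w}} {A : Type u}
    [L.Structure A] [Nonempty A] (h : HasBoundedStrictWidth L A)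
    {Rs : Set (Σ n, L.Relations n)} (hRs : Rs.Finite) :
    ∃ n : ℕ, 3 ≤ n ∧ ∀ X : Set (Fin n → A), X.Finite → ∃ f : (Fin n → A) → A,
      PreservesSymbols Rs X f ∧
        ∀ c ∈ X, ∀ (a : A) (i : Fin n), (∀ r, r ≠ i → c r = a) → f c = a := by
  classical
  obtain ⟨m, hm, ℓ, hℓ, H⟩ := h
  obtain ⟨p, hp⟩ : ∃ p : ℕ, ∀ R ∈ Rs, R.1 ≤ p := by
    obtain ⟨p, hp⟩ := (hRs.image fun R => R.1).bddAbove
    exact ⟨p, fun R hR => hp ⟨R, hR, rfl⟩⟩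
  -- Every scope of the instance `J` below has at most `max ℓ p` variables, so the arity exceeds all
  -- of them.
  set n := max ℓ p + 1 with hn
  have hn3 : 3 ≤ n := by omega
  refine ⟨n, hn3, fun X hX => ?_⟩
  obtain ⟨N, ⟨eX⟩⟩ := hX.to_subtype.exists_equiv_fin
  set col : Fin N → Fin n → A := fun v => (eX.symm v).1 with hcol
  -- The variables are the columns, and the constraints are the atomic facts that hold in every row.
  -- Nullary facts are left out because scopes must be non-empty; they are preserved trivially.
  set At : Set (Σ R : (Σ l, L.Relations l), Fin R.1 → Fin N) :=
    {a | a.1 ∈ Rs ∧ 0 < a.1.1 ∧ ∀ r, Structure.RelMap a.1.2 (fun i => col (a.2 i) r)} with hAtdef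
  have hAt : At.Finite := by
    refine (hRs.biUnion fun R _ => Set.finite_range
      (fun t : Fin R.1 → Fin N => (⟨R, t⟩ : Σ R : (Σ l, L.Relations l), Fin R.1 → Fin N))).subset ?_
    rintro ⟨R, t⟩ ha
    exact Set.mem_biUnion ha.1 ⟨t, rfl⟩
  set IsSol : (Fin N → A) → Prop := fun s => ∀ a ∈ At, Structure.RelMap a.1.2 (s ∘ a.2) with hSol
  set mk : (Σ R : (Σ l, L.Relations l), Fin R.1 → Fin N) → Constraint (Fin N) A := fun a =>
    ⟨Set.range a.2, {f | Structure.RelMap a.1.2 (f ∘ Set.rangeFactorization a.2)}⟩ with hmk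
  set I : Set (Constraint (Fin N) A) := mk '' At with hI
  have solI : ∀ s, IsSolution I s ↔ IsSol s := by
    intro s
    constructor
    · intro hs a ha
      exact hs (mk a) ⟨a, ha, rfl⟩
    · rintro hs _ ⟨a, ha, rfl⟩
      exact hs a ha
  -- The constraints of `J` are projections of the full solution set, so minimality is automatic;
  -- including the original scopes keeps the solutions unchanged.
  set prj : Set (Fin N) → Constraint (Fin N) A := fun W =>
    ⟨W, {g | ∃ s, IsSol s ∧ ∀ x : W, s x = g x}⟩ with hprj
  set Ws : Set (Set (Fin N)) := {W | W.Nonempty ∧ (W.ncard ≤ ℓ ∨ ∃ a ∈ At, W = Set.range a.2)}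
    with hWs
  set J : Set (Constraint (Fin N) A) := prj '' Ws with hJ
  have hcard : ∀ W ∈ Ws, W.ncard ≤ ℓ ∨ ∃ a ∈ At, W.ncard ≤ a.1.1 := by
    rintro W ⟨-, hW | ⟨a, ha, rfl⟩⟩
    · exact Or.inl hW
    · refine Or.inr ⟨a, ha, ?_⟩
      rw [← Set.image_univ]
      refine (Set.ncard_image_le Set.finite_univ).trans ?_
      simp [Set.ncard_univ]
  have instI : IsInstance (basicRelations L A) I := by
    refine ⟨hAt.image _, ?_⟩
    rintro _ ⟨a, ha, rfl⟩
    refine ⟨⟨a.2 ⟨0, ha.2.1⟩, ⟨_, rfl⟩⟩, a.1.1, Set.rangeFactorization a.2, _,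
      Set.rangeFactorization_surjective, ⟨a.1.2, rfl⟩, rfl⟩
  have instJ : IsInstance (ppRelations L A ℓ) J := by
    refine ⟨(Set.toFinite Ws).image _, ?_⟩
    rintro _ ⟨W, hW, rfl⟩
    refine ⟨hW.1, W.ncard, ?_⟩
    obtain ⟨e⟩ : Nonempty (Fin W.ncard ≃ W) := by
      rw [← Nat.card_coe_set_eq]
      exact ⟨(Finite.equivFin W).symm⟩
    have hpos : 0 < W.ncard := by
      rw [Set.ncard_pos]
      exact hW.1
    refine ⟨e, _, e.surjective, ⟨ppDefinable_projection hpos hAt (fun i => (e i : Fin N)), ?_⟩, ?_⟩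
    · rcases hcard W hW with h | ⟨a, _, h⟩
      · exact Or.inl h
      · exact Or.inr ⟨_, h, ⟨a.1.2⟩⟩
    · ext g
      constructor
      · rintro ⟨s, hs, hg⟩
        exact ⟨s, hs, fun i => hg (e i)⟩
      · rintro ⟨s, hs, hg⟩
        refine ⟨s, hs, fun x => ?_⟩
        obtain ⟨i, rfl⟩ := e.surjective x
        exact hg i
  have solJ : ∀ s, IsSolution J s ↔ IsSolution I s := by
    intro s
    rw [solI]
    constructor
    · intro hs a ha
      obtain ⟨s', hs', h'⟩ := hs (prj (Set.range a.2))
        (Set.mem_image_of_mem prj (show Set.range a.2 ∈ Ws from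
          ⟨⟨a.2 ⟨0, ha.2.1⟩, ⟨_, rfl⟩⟩, Or.inr ⟨a, ha, rfl⟩⟩))
      have : s ∘ a.2 = s' ∘ a.2 := by
        funext i
        exact (h' ⟨a.2 i, ⟨i, rfl⟩⟩).symm
      rw [this]
      exact hs' a ha
    · rintro hs _ ⟨W, hW, rfl⟩
      exact ⟨s, hs, fun _ => rfl⟩
  have minJ : IsMinimalInstance m ℓ J := by
    constructor
    · intro q hq hqℓ t
      refine ⟨prj (Set.range t), Set.mem_image_of_mem prj (show Set.range t ∈ Ws from
        ⟨⟨t ⟨0, hq⟩, ⟨_, rfl⟩⟩, Or.inl ?_⟩), subset_rfl⟩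
      rw [← Set.image_univ]
      refine (Set.ncard_image_le Set.finite_univ).trans ?_
      simpa [Set.ncard_univ] using hqℓ
    · have key : ∀ (q : ℕ) (t : Fin q → Fin N) (W : Set (Fin N)), Set.range t ⊆ W →
          (prj W).proj t = {z | ∃ s, IsSol s ∧ ∀ i, s (t i) = z i} := by
        intro q t W hW
        ext z
        constructor
        · rintro ⟨f, ⟨s, hs, hf⟩, hz⟩
          refine ⟨s, hs, fun i => ?_⟩
          obtain ⟨hi, h⟩ := hz i
          rw [← h]
          exact hf ⟨t i, hi⟩
        · rintro ⟨s, hs, hz⟩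
          exact ⟨fun x => s x, ⟨s, hs, fun _ => rfl⟩, fun i => ⟨hW ⟨i, rfl⟩, hz i⟩⟩
      rintro q - - t _ ⟨W₁, -, rfl⟩ _ ⟨W₂, -, rfl⟩ h₁ h₂
      rw [key q t W₁ h₁, key q t W₂ h₂]
  -- The partial assignment sends each column that is constant outside one row to that constant;
  -- `ex` is the exceptional row.
  set U : Set (Fin N) := {v | ∃ (a : A) (i : Fin n), ∀ r, r ≠ i → col v r = a} with hU
  choose g ex hg using fun v : U => v.2
  have hpart : IsPartialSolution J U g := by
    rintro _ ⟨W, hW, rfl⟩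
    have hlt : W.ncard < n := by
      rcases hcard W hW with h | ⟨a, ha, h⟩
      · omega
      · have := hp _ ha.1
        omega
    set exW : Fin N → Fin n := fun v => if h : v ∈ U then ex ⟨v, h⟩ else ⟨0, by omega⟩ with hexW
    -- With fewer than `n` columns in the scope, some row is exceptional for none of them. That row
    -- is a solution which agrees with `g` on the scope.
    obtain ⟨r, hr⟩ : ∃ r, r ∉ exW '' W := by
      by_contra hcon
      push Not at hcon
      have h1 : (exW '' W).ncard = n := by
        rw [Set.eq_univ_of_forall hcon]
        simp [Set.ncard_univ]
      have h2 := Set.ncard_image_le (f := exW) (Set.toFinite W)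
      omega
    refine ⟨fun x => col x r, ⟨fun v => col v r, fun a ha => ha.2.2 r, fun _ => rfl⟩, ?_⟩
    intro x hxU hxW
    refine hg ⟨x, hxU⟩ r fun h => hr ⟨x, hxW, ?_⟩
    rw [hexW, h]
    simp [hxU]
  obtain ⟨f₀, hf₀, hfg⟩ := H (Fin N) I J instI instJ solJ minJ U g hpart
  rw [solJ, solI] at hf₀
  have hcolX : ∀ (c) (hc : c ∈ X), col (eX ⟨c, hc⟩) = c := by
    intro c hc
    simp [hcol]
  refine ⟨fun c => if hc : c ∈ X then f₀ (eX ⟨c, hc⟩) else Classical.arbitrary A, ?_, ?_⟩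
  · intro R hR t ht hr
    rcases Nat.eq_zero_or_pos R.1 with h0 | hpos
    · convert hr ⟨0, by omega⟩ using 1
      funext i
      exact absurd i.2 (by omega)
    · have := hf₀ ⟨R, fun i => eX ⟨t i, ht i⟩⟩ ⟨hR, hpos, fun r => by
        simpa only [hcolX] using hr r⟩
      convert this using 1
      funext i
      simp [ht i]
  · intro c hc a i hi
    have hv : eX ⟨c, hc⟩ ∈ U := ⟨a, i, by rw [hcolX]; exact hi⟩
    simp only [hc, dif_pos]
    refine (hfg ⟨_, hv⟩).trans ?_
    have h1 := hg ⟨_, hv⟩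
    simp only [hcolX] at h1
    -- The constant chosen by `g` may come with another exceptional row than `i`; since `n ≥ 3`, a
    -- third row shows that both constants agree.
    obtain ⟨r, hr1, hr2⟩ : ∃ r : Fin n, r ≠ i ∧ r ≠ ex ⟨_, hv⟩ := by
      have : 2 < Fintype.card (Fin n) := by simp; omega
      obtain ⟨r, hr⟩ : ∃ r, r ∉ ({i, ex ⟨_, hv⟩} : Finset (Fin n)) := by
        by_contra hcon
        push Not at hcon
        have h2 : ({i, ex ⟨_, hv⟩} : Finset (Fin n)) = Finset.univ :=
          Finset.eq_univ_of_forall hcon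
        have h3 := Finset.card_le_two (a := i) (b := ex ⟨_, hv⟩)
        rw [h2, Finset.card_univ] at h3
        omega
      simp only [Finset.mem_insert, Finset.mem_singleton, not_or] at hr
      exact ⟨r, hr.1, hr.2⟩
    rw [← h1 r hr2, hi r hr1]

/-- Bounded strict width yields, for finitely many pp-formulas, a family of operations indexed by
finite sets of columns which eventually preserve the formulas and are eventually near-unanimous. -/
theorem HasBoundedStrictWidth.exists_family {L : FirstOrder.Language.{v, w}} [L.IsRelational]
    {A : Type u} [L.Structure A] [Nonempty A] (h : HasBoundedStrictWidth L A)
    {κ : Type} [Finite κ] (V : κ → Type) [∀ i, Finite (V i)] (φ : ∀ i, L.Formula (V i))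
    (hφ : ∀ i, IsPP (φ i)) :
    ∃ n : ℕ, 0 < n ∧ ∃ F : Finset (Fin n → A) → (Fin n → A) → A,
      (∀ i, ∀ c : V i → Fin n → A, (∀ r, (fun x => c x r) ∈ sols A (φ i)) →
        ∀ᶠ X in Filter.atTop, (fun x => F X (c x)) ∈ sols A (φ i)) ∧
      ∀ (c : Fin n → A) (a : A) (i : Fin n), (∀ r, r ≠ i → c r = a) →
        ∀ᶠ X in Filter.atTop, F X c = a := by
  choose Rs hfin hRs using fun i => (hφ i).exists_preserves (A := A)
  obtain ⟨n, hn, hF⟩ := h.exists_nearUnanimity (Set.finite_iUnion hfin)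
  -- There is one operation for each finite set of columns. Every single demand holds from some
  -- finite set on, so finitely many demands can be met together, as if by one global operation.
  choose F hF₁ hF₂ using fun X : Finset (Fin n → A) => hF X X.finite_toSet
  refine ⟨n, by omega, F, ?_, ?_⟩
  · intro i c hc
    obtain ⟨X', hX', hsub, hpres⟩ := hRs i n (Set.range c) (Set.finite_range c)
    filter_upwards [Filter.eventually_ge_atTop hX'.toFinset] with X hX
    have h1 := hpres (F X) ((hF₁ X).mono (Set.subset_iUnion Rs i) (fun x hx => by
      have := hX (hX'.mem_toFinset.2 hx)
      exact this)) c default (fun j => ⟨j, rfl⟩) (fun j => j.elim0) (fun r => by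
        have := hc r
        change BoundedFormula.Realize (φ i) _ default at this
        convert this using 1)
    change BoundedFormula.Realize (φ i) _ default
    convert h1 using 1
  · intro c a i hc
    filter_upwards [Filter.eventually_ge_atTop {c}] with X hX
    exact hF₂ X c (hX (Finset.mem_singleton_self c)) a i hc

/-! ### Homogeneity, and finite duality as a local satisfiability criterion -/

theorem smul_tuple_apply {A : Type u} (G : Subgroup (Equiv.Perm A)) {ι : Type*} (g : G)
    (a : ι → A) (i : ι) : (g • a) i = g.1 (a i) := rfl

/-- Homogeneity for families indexed by a finite type, possibly with repetitions. -/
theorem IsKHomogeneous.exists_smul_eq {A : Type u} {G : Subgroup (Equiv.Perm A)} {k : ℕ}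
    (hG : IsKHomogeneous G k) {J : Type*} [Finite J] {a b : J → A}
    (hk : k ≤ (Set.range a).ncard) (hab : ∀ i j, a i = a j → b i = b j)
    (h : ∀ e : Fin k → J, Function.Injective (a ∘ e) → b ∘ e ∈ MulAction.orbit G (a ∘ e)) :
    ∃ g : G, b = g • a := by
  have hfin : (Set.range a).Finite := Set.finite_range a
  obtain ⟨e⟩ : Nonempty (Fin (Set.range a).ncard ≃ Set.range a) := by
    rw [← Nat.card_coe_set_eq]
    exact ⟨(Finite.equivFin _).symm⟩
  choose τ hτ using fun i => (e i).2
  obtain ⟨g, hg⟩ := hG _ hk (b ∘ τ) (a ∘ τ) fun s => h (τ ∘ s) (by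
    intro i j hij
    simp only [Function.comp_apply, hτ] at hij
    exact s.injective (e.injective (Subtype.ext hij)))
  refine ⟨g, funext fun j => ?_⟩
  obtain ⟨i, hi⟩ := e.surjective ⟨a j, j, rfl⟩
  have h1 : a (τ i) = a j := by rw [hτ, hi]
  rw [hab j (τ i) h1.symm, smul_tuple_apply, ← h1]
  exact (congrFun hg i).symm

/-- The structure on `K` in which labelled tuples of vertices carry the orbits of their labels. -/
@[reducible] def labelStructure {A : Type u} (G : Subgroup (Equiv.Perm A)) (k : ℕ) {N : Type*}
    (Λ : (Fin k → N) → (Fin k → A) → Prop) {K : Type*} (val : K → N) :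
    (canonicalLanguage G k).Structure K where
  funMap := fun f _ => nomatch f
  RelMap := fun {n} R t => ∃ (hk : k = n) (e : Fin k → N) (a : Fin k → A), Λ e a ∧
    (∀ i, val (t (Fin.cast hk i)) = e i) ∧
    ∀ z : Fin n → A, z ∘ Fin.cast hk ∈ MulAction.orbit G a → z ∈ R.1

/-- Under finite duality, a finite system of orbit constraints is satisfiable if all its
restrictions to boundedly many vertices are. -/
theorem HasFiniteDuality.exists_bound {A : Type u} [Nonempty A] {G : Subgroup (Equiv.Perm A)}
    {k : ℕ} (hB : HasFiniteDuality (canonicalLanguage G k) A) :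
    ∃ b : ℕ, ∀ {N : Type u} (X : Finset N) (Λ : (Fin k → N) → (Fin k → A) → Prop),
      (∀ e a, Λ e a → Function.Injective a) →
      (∀ Y : Finset N, Y.card ≤ b → ∃ h : N → A,
        ∀ e a, Λ e a → (∀ i, e i ∈ Y) → h ∘ e ∈ MulAction.orbit G a) →
      ∃ h : N → A, ∀ e a, Λ e a → (∀ i, e i ∈ X) → h ∘ e ∈ MulAction.orbit G a := by
  classical
  obtain ⟨F, hF, hFfin, hdual⟩ := hB
  obtain ⟨b, hb⟩ : ∃ b : ℕ, ∀ S ∈ F, Nat.card S ≤ b := by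
    obtain ⟨b, hb⟩ := (hF.image fun S : CategoryTheory.Bundled.{0} (canonicalLanguage G k).Structure => Nat.card S).bddAbove
    exact ⟨b, fun S hS => hb ⟨S, hS, rfl⟩⟩
  refine ⟨b, fun {N} X Λ hΛ hloc => ?_⟩
  have toHom : ∀ {K : Type} (val : K → N) (h : N → A),
      (∀ e a, Λ e a → (∀ i, e i ∈ Set.range val) → h ∘ e ∈ MulAction.orbit G a) →
      Nonempty (@FirstOrder.Language.Hom (canonicalLanguage G k) K A
        (labelStructure G k Λ val) _) := by
    intro K val h hh
    let := labelStructure G k Λ val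
    refine ⟨⟨h ∘ val, (fun f => nomatch f), ?_⟩⟩
    rintro n R t ⟨hk, e, a, hΛe, hval, hz⟩
    refine hz _ ?_
    have h1 := hh e a hΛe fun i => ⟨_, hval i⟩
    convert h1 using 1
    funext i
    simp [← hval]
  -- Finite duality concerns structures in `Type`, whereas the vertices live in `Type u`; hence the
  -- copy of `X`.
  set K := Fin X.card with hKdef
  set val : K → N := fun i => (X.equivFin.symm i).1 with hval
  let sK : (canonicalLanguage G k).Structure K := labelStructure G k Λ val
  have hK : Nonempty (K →[canonicalLanguage G k] A) := by
    refine (hdual (CategoryTheory.Bundled.of K) (inferInstanceAs (Finite (Fin _)))).2 ?_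
    intro S hS
    refine ⟨fun ψ => ?_⟩
    have : Finite S := hFfin S hS
    set Y : Finset N := (Set.finite_range (fun s : S => val (ψ s))).toFinset with hY
    have hYc : Y.card ≤ b := by
      rw [hY, ← Set.ncard_eq_toFinset_card _ (Set.finite_range _), ← Set.image_univ]
      refine (Set.ncard_image_le Set.finite_univ).trans ?_
      rw [Set.ncard_univ]
      exact hb S hS
    obtain ⟨h, hh⟩ := hloc Y hYc
    -- The image of an obstruction has at most `b` vertices, so its labels are satisfiable and it
    -- maps to `A`. But the obstruction also maps onto this image, which contradicts duality.
    set K' : Set K := Set.range ψ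
    set val' : K' → N := fun x => val x.1 with hval'
    let sK' : (canonicalLanguage G k).Structure K' := labelStructure G k Λ val'
    have hK' : Nonempty (K' →[canonicalLanguage G k] A) := by
      refine toHom val' h fun e a he hmem => hh e a he fun i => ?_
      obtain ⟨⟨_, s, rfl⟩, hx⟩ := hmem i
      rw [← hx]
      simp [hY, hval']
    refine ((hdual (CategoryTheory.Bundled.of K') (inferInstanceAs (Finite K'))).1 hK' S hS).false
      ⟨fun s => ⟨ψ s, s, rfl⟩, (fun f => nomatch f), ?_⟩
    intro n R t ht
    obtain ⟨hk, e, a, h1, h2, h3⟩ := ψ.map_rel' R t ht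
    exact ⟨hk, e, a, h1, h2, h3⟩
  obtain ⟨ψ⟩ := hK
  refine ⟨fun x => if hx : x ∈ X then ψ (X.equivFin ⟨x, hx⟩) else Classical.arbitrary A, ?_⟩
  intro e a he hX
  have h1 := ψ.map_rel' (⟨MulAction.orbit G a, rfl, a, hΛ e a he, rfl⟩ :
    (canonicalLanguage G k).Relations k) (fun i => X.equivFin ⟨e i, hX i⟩)
    ⟨rfl, e, a, he, fun i => by simp [hval], fun z hz => hz⟩
  change _ ∈ MulAction.orbit G a at h1
  convert h1 using 1
  funext i
  simp [hX i]

/-! ### Linked positions and the birth of their classes -/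

/-- `Traces lk t n p q`: following the links `lk` from time `t` for `n` steps leads from
position `p` to position `q`. -/
def Traces {ι : Type*} (lk : ℕ → ι → ι → Prop) (t : ℕ) : ℕ → ι → ι → Prop
  | 0, p, q => p = q
  | n + 1, p, q => ∃ p', Traces lk t n p p' ∧ lk (t + n) p' q

open Classical in
/-- The earliest time and position from which links lead to position `p` at time `t`. -/
noncomputable def birth {ι : Type*} (lk : ℕ → ι → ι → Prop) : ℕ → ι → ℕ × ι
  | 0, p => (0, p)
  | t + 1, q => if h : ∃ p, lk t p q then birth lk t h.choose else (t + 1, q)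

section Links

variable {ι : Type*} {lk : ℕ → ι → ι → Prop}

theorem birth_succ_of_not {t : ℕ} {q : ι} (h : ¬∃ p, lk t p q) : birth lk (t + 1) q = (t + 1, q) := by
  simp only [birth, h, dif_neg, not_false_iff]

theorem birth_succ_of_link (hl : ∀ t p p' q, lk t p q → lk t p' q → p = p') {t : ℕ} {p q : ι}
    (h : lk t p q) : birth lk (t + 1) q = birth lk t p := by
  have h' : ∃ p, lk t p q := ⟨p, h⟩
  simp only [birth, h', dif_pos]
  rw [hl t _ _ q h'.choose_spec h]

theorem birth_fst_le (hl : ∀ t p p' q, lk t p q → lk t p' q → p = p') (t : ℕ) (p : ι) :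
    (birth lk t p).1 ≤ t := by
  induction t generalizing p with
  | zero => simp [birth]
  | succ t ih =>
    by_cases h : ∃ p', lk t p' p
    · obtain ⟨p', h⟩ := h
      rw [birth_succ_of_link hl h]
      exact (ih p').trans t.le_succ
    · rw [birth_succ_of_not h]

theorem birth_injective (hl : ∀ t p p' q, lk t p q → lk t p' q → p = p')
    (hr : ∀ t p q q', lk t p q → lk t p q' → q = q') (t : ℕ) :
    Function.Injective (birth lk t) := by
  induction t with
  | zero =>
    intro p q h
    simpa [birth] using h
  | succ t ih =>
    intro p q h
    by_cases hp : ∃ p', lk t p' p <;> by_cases hq : ∃ q', lk t q' q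
    · obtain ⟨p', hp⟩ := hp
      obtain ⟨q', hq⟩ := hq
      rw [birth_succ_of_link hl hp, birth_succ_of_link hl hq] at h
      obtain rfl := ih h
      exact hr t _ _ _ hp hq
    · obtain ⟨p', hp⟩ := hp
      rw [birth_succ_of_link hl hp, birth_succ_of_not hq] at h
      have := birth_fst_le hl t p'
      rw [h] at this
      exact absurd this (by simp)
    · obtain ⟨q', hq⟩ := hq
      rw [birth_succ_of_link hl hq, birth_succ_of_not hp] at h
      have := birth_fst_le hl t q'
      rw [← h] at this
      exact absurd this (by simp)
    · rw [birth_succ_of_not hp, birth_succ_of_not hq] at h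
      exact (Prod.ext_iff.1 h).2

theorem link_of_birth_eq (hl : ∀ t p p' q, lk t p q → lk t p' q → p = p')
    (hr : ∀ t p q q', lk t p q → lk t p q' → q = q') {t : ℕ} {p q : ι}
    (h : birth lk (t + 1) q = birth lk t p) : lk t p q := by
  by_cases hq : ∃ p', lk t p' q
  · obtain ⟨p', hq⟩ := hq
    rw [birth_succ_of_link hl hq] at h
    rwa [← birth_injective hl hr t h]
  · rw [birth_succ_of_not hq] at h
    have := birth_fst_le hl t p
    rw [← h] at this
    exact absurd this (by simp)

/-- Links are partial injections, so a class alive at two times can be followed back position by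
position. This turns bounds on birth times into traces. -/
theorem exists_traces_of_birth_le (hl : ∀ t p p' q, lk t p q → lk t p' q → p = p') {s n : ℕ} {p : ι}
    (h : (birth lk (s + n) p).1 ≤ s) :
    ∃ p', birth lk s p' = birth lk (s + n) p ∧ Traces lk s n p' p := by
  induction n generalizing p with
  | zero => exact ⟨p, rfl, rfl⟩
  | succ n ih =>
    by_cases hp : ∃ p', lk (s + n) p' p
    · obtain ⟨p', hp⟩ := hp
      have h1 := birth_succ_of_link hl hp
      rw [← Nat.add_assoc, h1] at h ⊢
      obtain ⟨q, hq, hq'⟩ := ih h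
      exact ⟨q, hq, p', hq', hp⟩
    · rw [← Nat.add_assoc, birth_succ_of_not hp] at h
      simp only at h
      omega

theorem Traces.birth_eq (hl : ∀ t p p' q, lk t p q → lk t p' q → p = p') {s n : ℕ} {p q : ι}
    (h : Traces lk s n p q) : birth lk (s + n) q = birth lk s p := by
  induction n generalizing q with
  | zero => rw [Nat.add_zero, show p = q from h]
  | succ n ih =>
    obtain ⟨p', h1, h2⟩ := h
    rw [← Nat.add_assoc, birth_succ_of_link hl h2, ih h1]

theorem apply_birth {A : Type*} (hl : ∀ t p p' q, lk t p q → lk t p' q → p = p') {w : ℕ → ι → A}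
    (hw : ∀ t p q, lk t p q → w t p = w (t + 1) q) (t : ℕ) (p : ι) :
    w (birth lk t p).1 (birth lk t p).2 = w t p := by
  induction t generalizing p with
  | zero => rfl
  | succ t ih =>
    by_cases h : ∃ p', lk t p' p
    · obtain ⟨p', h⟩ := h
      rw [birth_succ_of_link hl h, ih, hw t p' p h]
    · rw [birth_succ_of_not h]

theorem birth_mul_eq (hl : ∀ t p p' q, lk t p q → lk t p' q → p = p') {M : ℕ} {S : Set ι}
    (hS : ∀ j p q, Traces lk (j * M) M p q ↔ p = q ∧ q ∈ S) {q : ι} (hq : q ∈ S) (j : ℕ) :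
    birth lk (j * M) q = (0, q) := by
  induction j with
  | zero => rw [Nat.zero_mul]; rfl
  | succ j ih => rw [Nat.succ_mul, ((hS j q q).2 ⟨rfl, hq⟩).birth_eq hl, ih]

/-- A class that is alive throughout a full period is permanent. -/
theorem birth_eq_of_le (hl : ∀ t p p' q, lk t p q → lk t p' q → p = p') {M : ℕ} {S : Set ι}
    (hS : ∀ j p q, Traces lk (j * M) M p q ↔ p = q ∧ q ∈ S) {j t : ℕ} {p : ι}
    (h : (birth lk t p).1 ≤ j * M) (ht : (j + 1) * M ≤ t) : ∃ s ∈ S, birth lk t p = (0, s) := by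
  obtain ⟨n, rfl⟩ := Nat.exists_eq_add_of_le ht
  -- The class has representatives at the times `j * M` and `(j + 1) * M`, joined by a trace over
  -- exactly one period; by `hS` they are the same position, and it lies in `S`.
  obtain ⟨p₁, h₁, -⟩ := exists_traces_of_birth_le hl (h.trans (Nat.mul_le_mul_right M j.le_succ))
  rw [← h₁, Nat.succ_mul] at h
  obtain ⟨p₂, -, h₂⟩ := exists_traces_of_birth_le hl h
  obtain ⟨-, hp⟩ := (hS j p₂ p₁).1 h₂
  exact ⟨p₁, hp, by rw [← h₁, birth_mul_eq hl hS hp]⟩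

end Links

/-! ### Paths with prescribed ends -/

/-- The required path is a solution of a finite system of orbit constraints on classes of linked
positions, with the two ends fixed. By finite duality only boundedly many classes need be considered
at once. These leave some stretch of the path without births, and there a translate of `u` that fits
`a` can be cut and continued by one that fits `b`: across the cut only the classes of `S` persist,
and on them the two translates agree. -/
theorem exists_smul_chain {A : Type u} {G : Subgroup (Equiv.Perm A)} {k : ℕ}
    (hG : IsKHomogeneous G k) (hB : HasFiniteDuality (canonicalLanguage G k) A) [Nonempty A] :
    ∃ T₀ : ℕ, ∀ {ι : Type} [Finite ι] (u : ℕ → ι → A), (∀ t, Function.Injective (u t)) →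
      (∀ t, k ≤ (Set.range (u t) ∪ Set.range (u (t + 1))).ncard) →
      ∀ (M : ℕ), 0 < M → ∀ (S : Set ι), S.ncard < k →
      (∀ j p q, Traces (fun t p q => u t p = u (t + 1) q) (j * M) M p q ↔ p = q ∧ q ∈ S) →
      ∀ T, T₀ ≤ T → ∀ a ∈ MulAction.orbit G (u 0), ∀ b ∈ MulAction.orbit G (u (T * M)),
      (∀ i ∈ S, a i = b i) →
      ∃ w : ℕ → ι → A, w 0 = a ∧ w (T * M) = b ∧
        ∀ t < T * M, ∃ g : G, w t = g • u t ∧ w (t + 1) = g • u (t + 1) := by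
  classical
  obtain ⟨B, hloc⟩ := hB.exists_bound
  -- This leaves room for `B + 1` disjoint blocks of three periods each.
  refine ⟨3 * B + 3, ?_⟩
  intro ι _ u hu hku M hM S hSk hS T hT a ha b hb hab
  set lk : ℕ → ι → ι → Prop := fun t p q => u t p = u (t + 1) q with hlk
  have hl : ∀ t p p' q, lk t p q → lk t p' q → p = p' :=
    fun t p p' q h h' => hu t (h.trans h'.symm)
  have hr : ∀ t p q q', lk t p q → lk t p q' → q = q' :=
    fun t p q q' h h' => hu (t + 1) (h.symm.trans h')
  obtain ⟨ga, rfl⟩ := ha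
  obtain ⟨gb, rfl⟩ := hb
  set lf : ℕ → ι → A := fun t => ga • u t with hlf
  set rt : ℕ → ι → A := fun t => gb • u t with hrt
  have hlfw : ∀ t p q, lk t p q → lf t p = lf (t + 1) q :=
    fun t p q h => congrArg ga.1 h
  have hrtw : ∀ t p q, lk t p q → rt t p = rt (t + 1) q :=
    fun t p q h => congrArg gb.1 h
  have span : ∀ {j t : ℕ} {p : ι}, (birth lk t p).1 ≤ j * M → (j + 1) * M ≤ t →
      ∃ s ∈ S, birth lk t p = (0, s) := fun h ht => birth_eq_of_le hl hS h ht
  have hab' : ∀ s ∈ S, rt 0 s = lf 0 s := by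
    intro s hs
    have h1 := apply_birth hl hrtw (T * M) s
    rw [birth_mul_eq hl hS hs] at h1
    exact h1.trans (hab s hs).symm
  -- names of the vertices
  set κ : ℕ → ι → A ⊕ (ℕ × ι) := fun t p =>
    if (birth lk t p).1 = 0 then Sum.inl (lf 0 (birth lk t p).2)
    else if h : ∃ q, birth lk (T * M) q = birth lk t p then Sum.inl (rt (T * M) h.choose)
    else Sum.inr (birth lk t p) with hκ
  have κ_congr : ∀ {t t' : ℕ} {p p' : ι}, birth lk t p = birth lk t' p' → κ t p = κ t' p' := by
    intro t t' p p' h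
    simp only [hκ, h]
  have κ_zero : ∀ p, κ 0 p = Sum.inl (lf 0 p) := by
    intro p
    simp [hκ, birth]
  have κ_end : ∀ q, κ (T * M) q = Sum.inl (rt (T * M) q) := by
    intro q
    by_cases h0 : (birth lk (T * M) q).1 = 0
    · obtain ⟨s, hs, h⟩ := span (j := 0) (t := T * M) (p := q) (by omega)
        (Nat.mul_le_mul_right M (by omega))
      have h2 := apply_birth hl hrtw (T * M) q
      simp only [hκ, h0, if_true]
      rw [← h2, h]
      simp only [hab' s hs]
    · have h' : ∃ q', birth lk (T * M) q' = birth lk (T * M) q := ⟨q, rfl⟩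
      simp only [hκ, h0, if_false, h', dif_pos]
      rw [birth_injective hl hr _ h'.choose_spec]
  -- The entries of `u 0` and `u 1` are added only so that `E` has at least `k` elements, as
  -- homogeneity requires.
  set E : Set A := Set.range (lf 0) ∪ Set.range (rt (T * M)) ∪ (Set.range (u 0) ∪ Set.range (u 1))
    with hE
  have hEfin : E.Finite := ((Set.finite_range _).union (Set.finite_range _)).union
    ((Set.finite_range _).union (Set.finite_range _))
  set U : ℕ → ι ⊕ ι → A := fun t => Sum.elim (u t) (u (t + 1)) with hU
  set K : ℕ → ι ⊕ ι → A ⊕ (ℕ × ι) := fun t => Sum.elim (κ t) (κ (t + 1)) with hK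
  set Λ : (Fin k → A ⊕ (ℕ × ι)) → (Fin k → A) → Prop := fun e x =>
    (Function.Injective x ∧ (∀ i, x i ∈ E) ∧ e = Sum.inl ∘ x) ∨
    (∃ t < T * M, ∃ d : Fin k → ι ⊕ ι, Function.Injective (U t ∘ d) ∧ x = U t ∘ d ∧ e = K t ∘ d)
    with hΛ
  have hΛinj : ∀ e x, Λ e x → Function.Injective x := by
    rintro e x (⟨h, -⟩ | ⟨t, -, d, h, rfl, -⟩)
    · exact h
    · exact h
  set X : Finset (A ⊕ (ℕ × ι)) := (hEfin.image Sum.inl).toFinset ∪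
    (Set.finite_range (fun x : Fin (T * M) × (ι ⊕ ι) => K x.1 x.2)).toFinset with hX
  obtain ⟨h, hh⟩ := hloc X Λ hΛinj (by
    intro Y hY
    -- At most `B` of the `B + 1` blocks contain the birth of a class in `Y`. The cut is made in the
    -- middle period `j` of a block without any; sending the named elements of `A` to block 0 does
    -- no harm.
    obtain ⟨i₀, hi₀, hi₁⟩ : ∃ i₀ ∈ Finset.range (B + 1),
        i₀ ∉ Y.image (Sum.elim (fun _ => 0) (fun x : ℕ × ι => x.1 / M / 3)) := by
      refine Finset.exists_mem_notMem_of_card_lt_card ?_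
      rw [Finset.card_range]
      exact (Finset.card_image_le.trans hY).trans_lt (Nat.lt_succ_self B)
    rw [Finset.mem_range] at hi₀
    set j := 3 * i₀ + 1 with hj
    refine ⟨Sum.elim id (fun x => if x.1 ≤ j * M then lf x.1 x.2 else rt x.1 x.2), ?_⟩
    set hom : A ⊕ (ℕ × ι) → A :=
      Sum.elim id (fun x => if x.1 ≤ j * M then lf x.1 x.2 else rt x.1 x.2) with hhom
    have hend : ∀ t p q, t ≤ T * M → (birth lk t p).1 ≠ 0 → birth lk (T * M) q = birth lk t p →
        j * M < (birth lk t p).1 := by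
      intro t p q ht h0 hq
      by_contra hle
      push Not at hle
      rw [← hq] at hle
      obtain ⟨s, -, h⟩ := span hle (Nat.mul_le_mul_right M (by omega))
      rw [← hq, h] at h0
      exact h0 rfl
    have hleft : ∀ t p, t ≤ j * M → hom (κ t p) = lf t p := by
      intro t p ht
      have hb := birth_fst_le hl t p
      have hv := apply_birth hl hlfw t p
      by_cases h0 : (birth lk t p).1 = 0
      · simp only [hκ, h0, if_true, hhom, Sum.elim_inl, id]
        rw [← hv, h0]
      · have h1 : ¬∃ q, birth lk (T * M) q = birth lk t p := by
          rintro ⟨q, hq⟩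
          have := hend t p q (ht.trans (Nat.mul_le_mul_right M (by omega))) h0 hq
          omega
        simp only [hκ, h0, if_false, h1, dif_neg, not_false_iff, hhom, Sum.elim_inr]
        rw [if_pos (hb.trans ht), hv]
    have hright : ∀ t p, (j + 1) * M ≤ t → t ≤ T * M → hom (κ t p) = rt t p := by
      intro t p ht htT
      have hv := apply_birth hl hrtw t p
      by_cases h0 : (birth lk t p).1 = 0
      · obtain ⟨s, hs, hbs⟩ := span (j := j) (h0.le.trans (Nat.zero_le _)) ht
        simp only [hκ, h0, if_true, hhom, Sum.elim_inl, id]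
        rw [← hv, hbs]
        exact (hab' s hs).symm
      · have hlt : j * M < (birth lk t p).1 := by
          by_contra hle
          push Not at hle
          obtain ⟨s, -, h⟩ := span hle ht
          rw [h] at h0
          exact h0 rfl
        by_cases h1 : ∃ q, birth lk (T * M) q = birth lk t p
        · simp only [hκ, h0, if_false, h1, dif_pos, hhom, Sum.elim_inl, id]
          have h2 := apply_birth hl hrtw (T * M) h1.choose
          rw [h1.choose_spec] at h2
          exact h2.symm.trans hv
        · simp only [hκ, h0, if_false, h1, dif_neg, not_false_iff, hhom, Sum.elim_inr]
          rw [if_neg (by omega), hv]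
    rintro e x (⟨hx, -, rfl⟩ | ⟨t, ht, d, hd, rfl, rfl⟩) hmem
    · exact MulAction.mem_orbit_self _
    · rcases Nat.lt_or_ge t (j * M) with h1 | h1
      · refine ⟨ga, ?_⟩
        funext i
        change ga.1 (U t (d i)) = hom (K t (d i))
        rcases d i with p | p
        · exact (hleft t p h1.le).symm
        · exact (hleft (t + 1) p h1).symm
      rcases Nat.lt_or_ge t ((j + 1) * M) with h2 | h2
      -- A constraint inside the middle period involves `k` distinct classes, more than `S` has
      -- elements. One of them is not permanent, so it was born within the block and dies before the
      -- end: it is an unnamed vertex excluded from `Y`.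
      · exfalso
        set bd : ι ⊕ ι → ℕ × ι := Sum.elim (birth lk t) (birth lk (t + 1)) with hbd
        have hbdinj : ∀ x y, bd x = bd y → U t x = U t y := by
          rintro (p | p) (q | q) hpq
          · exact congrArg (u t) (birth_injective hl hr t hpq)
          · exact link_of_birth_eq hl hr hpq.symm
          · exact (link_of_birth_eq hl hr hpq).symm
          · exact congrArg (u (t + 1)) (birth_injective hl hr (t + 1) hpq)
        obtain ⟨i, hi⟩ : ∃ i, bd (d i) ∉ (fun s => ((0 : ℕ), s)) '' S := by
          by_contra hcon
          push Not at hcon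
          have hsub : Set.range (bd ∘ d) ⊆ (fun s => ((0 : ℕ), s)) '' S := by
            rintro _ ⟨i, rfl⟩
            exact hcon i
          have hinj : Function.Injective (bd ∘ d) := fun x y hxy => hd (hbdinj _ _ hxy)
          have h3 := Set.ncard_le_ncard hsub (Set.toFinite _)
          rw [← Set.image_univ, Set.ncard_image_of_injective _ hinj, Set.ncard_univ,
            Nat.card_fin] at h3
          have h4 := Set.ncard_image_le (f := fun s => ((0 : ℕ), s)) (Set.toFinite S)
          omega
        have key : ∀ t' p, j * M ≤ t' → t' ≤ (j + 1) * M →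
            birth lk t' p ∉ (fun s => ((0 : ℕ), s)) '' S → κ t' p ∉ Y := by
          intro t' p ht1 ht2 hns hY'
          have hle := birth_fst_le hl t' p
          have hlow : (j - 1) * M < (birth lk t' p).1 := by
            by_contra hcon
            push Not at hcon
            obtain ⟨s, hs, h⟩ := span hcon (by rwa [show j - 1 + 1 = j by omega])
            exact hns ⟨s, hs, h.symm⟩
          have h0 : (birth lk t' p).1 ≠ 0 := by omega
          have hnend : ¬∃ q, birth lk (T * M) q = birth lk t' p := by
            rintro ⟨q, hq⟩
            have hle' : (birth lk (T * M) q).1 ≤ (j + 1) * M := by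
              rw [hq]
              exact hle.trans ht2
            obtain ⟨s, hs, h⟩ := span hle' (Nat.mul_le_mul_right M (by omega))
            exact hns ⟨s, hs, by rw [← hq, h]⟩
          have hκv : κ t' p = Sum.inr (birth lk t' p) := by
            simp only [hκ, h0, if_false, hnend, dif_neg, not_false_iff]
          rw [hκv] at hY'
          refine hi₁ (Finset.mem_image.2 ⟨_, hY', ?_⟩)
          rw [Sum.elim_inr]
          have hd1 : 3 * i₀ ≤ (birth lk t' p).1 / M := by
            rw [Nat.le_div_iff_mul_le hM]
            rw [show j - 1 = 3 * i₀ by omega] at hlow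
            exact hlow.le
          have hd2 : (birth lk t' p).1 / M < 3 * i₀ + 3 := by
            rw [Nat.div_lt_iff_lt_mul hM]
            calc (birth lk t' p).1 ≤ (j + 1) * M := hle.trans ht2
              _ < (3 * i₀ + 3) * M := Nat.mul_lt_mul_of_pos_right (by omega) hM
          omega
        have hmi := hmem i
        change K t (d i) ∈ Y at hmi
        rcases hdi : d i with p | p
        · rw [hdi] at hmi hi
          exact key t p h1 h2.le hi hmi
        · rw [hdi] at hmi hi
          exact key (t + 1) p (by omega) h2 hi hmi
      · refine ⟨gb, ?_⟩
        funext i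
        change gb.1 (U t (d i)) = hom (K t (d i))
        rcases d i with p | p
        · exact (hright t p h2 ht.le).symm
        · exact (hright (t + 1) p (by omega) ht).symm)
  -- the solution agrees with an element of `G` on `E`
  have : Finite E := hEfin
  obtain ⟨g₀, hg₀⟩ := hG.exists_smul_eq (J := E) (a := Subtype.val) (b := fun x => h (Sum.inl x.1))
    (by
      rw [Subtype.range_coe]
      exact (hku 0).trans (Set.ncard_le_ncard Set.subset_union_right hEfin))
    (fun x y hxy => by rw [hxy])
    (fun e he => hh (Sum.inl ∘ Subtype.val ∘ e) _ (Or.inl ⟨he, fun i => (e i).2, rfl⟩) fun i => by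
      rw [hX, Finset.mem_union]
      left
      rw [Set.Finite.mem_toFinset]
      exact ⟨_, (e i).2, rfl⟩)
  have hinl : ∀ x ∈ E, h (Sum.inl x) = g₀.1 x := fun x hx => congrFun hg₀ ⟨x, hx⟩
  refine ⟨fun t p => (g₀⁻¹).1 (h (κ t p)), ?_, ?_, ?_⟩
  · funext p
    change (g₀⁻¹).1 (h (κ 0 p)) = lf 0 p
    rw [κ_zero, hinl _ (Or.inl (Or.inl ⟨p, rfl⟩))]
    exact Equiv.symm_apply_apply _ _
  · funext p
    change (g₀⁻¹).1 (h (κ (T * M) p)) = rt (T * M) p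
    rw [κ_end, hinl _ (Or.inl (Or.inr ⟨p, rfl⟩))]
    exact Equiv.symm_apply_apply _ _
  · intro t ht
    obtain ⟨g, hg⟩ := hG.exists_smul_eq (J := ι ⊕ ι) (a := U t) (b := fun x => h (K t x))
      (by
        rw [hU, Set.Sum.elim_range]
        exact hku t)
      (by
        have hcr : ∀ p q, u t p = u (t + 1) q → κ t p = κ (t + 1) q :=
          fun p q hpq => κ_congr (birth_succ_of_link hl hpq).symm
        rintro (p | p) (q | q) hpq
        · exact congrArg (fun x => h (κ t x)) (hu t hpq)
        · exact congrArg h (hcr p q hpq)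
        · exact congrArg h (hcr q p hpq.symm).symm
        · exact congrArg (fun x => h (κ (t + 1) x)) (hu (t + 1) hpq))
      (fun e he => hh (K t ∘ e) _ (Or.inr ⟨t, ht, e, he, rfl, rfl⟩) fun i => by
        rw [hX, Finset.mem_union]
        right
        rw [Set.Finite.mem_toFinset]
        exact ⟨(⟨t, ht⟩, e i), rfl⟩)
    refine ⟨g₀⁻¹ * g, ?_, ?_⟩
    · funext p
      exact congrArg (g₀⁻¹).1 (congrFun hg (Sum.inl p))
    · funext p
      exact congrArg (g₀⁻¹).1 (congrFun hg (Sum.inr p))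

/-! ### Traces of periodic links -/

theorem traces_add {ι : Type*} {lk : ℕ → ι → ι → Prop} {t m n : ℕ} {p q : ι} :
    Traces lk t (m + n) p q ↔ ∃ p', Traces lk t m p p' ∧ Traces lk (t + m) n p' q := by
  induction n generalizing q with
  | zero => exact ⟨fun h => ⟨q, h, rfl⟩, fun ⟨p', h, h'⟩ => (show p' = q from h') ▸ h⟩
  | succ n ih =>
    constructor
    · rintro ⟨q', h, hq⟩
      obtain ⟨p', h1, h2⟩ := ih.1 h
      exact ⟨p', h1, q', h2, by rwa [Nat.add_assoc]⟩
    · rintro ⟨p', h1, q', h2, hq⟩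
      exact ⟨q', ih.2 ⟨p', h1, h2⟩, Nat.add_assoc t m n ▸ hq⟩

theorem traces_periodic {ι : Type*} {lk : ℕ → ι → ι → Prop} {s : ℕ} (hs : ∀ t, lk (t + s) = lk t)
    (j n : ℕ) : Traces lk (j * s) n = Traces lk 0 n := by
  have h : ∀ t, lk (j * s + t) = lk t := by
    intro t
    induction j with
    | zero => simp
    | succ j ih => rw [Nat.succ_mul, Nat.add_right_comm, hs, ih]
  induction n with
  | zero => rfl
  | succ n ih =>
    funext p q
    change (∃ p', Traces lk (j * s) n p p' ∧ lk (j * s + n) p' q) =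
      ∃ p', Traces lk 0 n p p' ∧ lk (0 + n) p' q
    rw [ih, h, Nat.zero_add]

theorem Traces.left_unique {ι : Type*} {lk : ℕ → ι → ι → Prop}
    (hl : ∀ t p p' q, lk t p q → lk t p' q → p = p') {t n : ℕ} {p p' q : ι}
    (h : Traces lk t n p q) (h' : Traces lk t n p' q) : p = p' := by
  induction n generalizing q with
  | zero => exact h.trans h'.symm
  | succ n ih =>
    obtain ⟨x, h1, h2⟩ := h
    obtain ⟨y, h1', h2'⟩ := h'
    obtain rfl := hl _ _ _ _ h2 h2'
    exact ih h1 h1'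

theorem Traces.right_unique {ι : Type*} {lk : ℕ → ι → ι → Prop}
    (hr : ∀ t p q q', lk t p q → lk t p q' → q = q') {t n : ℕ} {p q q' : ι}
    (h : Traces lk t n p q) (h' : Traces lk t n p q') : q = q' := by
  induction n generalizing q q' with
  | zero => exact (show p = q from h).symm.trans h'
  | succ n ih =>
    obtain ⟨x, h1, h2⟩ := h
    obtain ⟨y, h1', h2'⟩ := h'
    obtain rfl := ih h1 h1'
    exact hr _ _ _ _ h2 h2'

/-- Over a suitable multiple of the period, periodic links trace a partial identity. -/
theorem exists_traces_partial_id {ι : Type*} [Finite ι] {lk : ℕ → ι → ι → Prop}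
    (hl : ∀ t p p' q, lk t p q → lk t p' q → p = p')
    (hr : ∀ t p q q', lk t p q → lk t p q' → q = q') {s : ℕ} (hs : ∀ t, lk (t + s) = lk t) :
    ∃ e, 0 < e ∧ ∃ S : Set ι, ∀ j p q, Traces lk (j * (e * s)) (e * s) p q ↔ p = q ∧ q ∈ S := by
  set R : ℕ → ι → ι → Prop := fun n => Traces lk 0 (n * s) with hR
  have hadd : ∀ m n p q, R (m + n) p q ↔ ∃ p', R m p p' ∧ R n p' q := by
    intro m n p q
    rw [hR]
    simp only
    rw [Nat.add_mul, traces_add, Nat.zero_add, traces_periodic hs]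
  obtain ⟨i, j, hij, hRij⟩ : ∃ i j, i < j ∧ R i = R j := by
    obtain ⟨i, j, hne, h⟩ := Finite.exists_ne_map_eq_of_infinite R
    rcases lt_or_gt_of_ne hne with h' | h'
    · exact ⟨i, j, h', h⟩
    · exact ⟨j, i, h', h.symm⟩
  have hstep : ∀ n, i ≤ n → R (n + (j - i)) = R n := by
    intro n hn
    obtain ⟨m, rfl⟩ := Nat.exists_eq_add_of_le hn
    funext p q
    rw [show i + m + (j - i) = j + m by omega]
    refine propext ?_
    rw [hadd, hadd, hRij]
  have hsteps : ∀ c n, i ≤ n → R (n + c * (j - i)) = R n := by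
    intro c
    induction c with
    | zero => intro n _; rw [Nat.zero_mul, Nat.add_zero]
    | succ c ih =>
      intro n hn
      rw [Nat.succ_mul, ← Nat.add_assoc, hstep _ (hn.trans (Nat.le_add_right _ _)), ih n hn]
  -- A multiple of the eventual period `j - i` that exceeds the preperiod `i`; hence `R e` is
  -- idempotent, and an idempotent partial injection is a partial identity.
  set e := (i + 1) * (j - i) with he
  have hie : i + 1 ≤ e := Nat.le_mul_of_pos_right _ (by omega)
  have hidem : R (e + e) = R e := hsteps (i + 1) e (by omega)
  refine ⟨e, by omega, {q | R e q q}, fun c p q => ?_⟩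
  rw [← Nat.mul_assoc, traces_periodic hs]
  change R e p q ↔ p = q ∧ R e q q
  constructor
  · intro h
    have h2 : R (e + e) p q := by rwa [hidem]
    obtain ⟨p', h3, h4⟩ := (hadd _ _ _ _).1 h2
    obtain rfl := Traces.left_unique hl h h4
    obtain rfl := Traces.right_unique hr h3 h
    exact ⟨rfl, h⟩
  · rintro ⟨rfl, h⟩
    exact h

/-! ### Periodic paths from finitely many orbits -/

section Sequences

variable {A : Type u} {G : Subgroup (Equiv.Perm A)} {k : ℕ}
  {St : ℕ → (Fin k → A) → (Fin k → A) → Prop}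

theorem apply_mul_add {α : Type*} {f : ℕ → α} {s : ℕ} (hs : ∀ t, f (t + s) = f t) (j t : ℕ) :
    f (j * s + t) = f t := by
  induction j with
  | zero => simp
  | succ j ih => rw [Nat.succ_mul, Nat.add_right_comm, hs, ih]

/-- The element of `G` that takes the start of the segment to its end generates the continuation:
the segment is repeated, translated by successive powers. -/
theorem exists_periodic_of_segment {s : ℕ} (hs : ∀ t, St (t + s) = St t)
    (hinv : ∀ t (g : G) a b, St t a b → St t (g • a) (g • b)) {m : ℕ} (hm : 0 < m * s)
    {a : ℕ → Fin k → A} (ha : ∀ t < m * s, St t (a t) (a (t + 1)))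
    (hend : a (m * s) ∈ MulAction.orbit G (a 0)) :
    ∃ u : ℕ → Fin k → A, u 0 = a 0 ∧ (∀ t, St t (u t) (u (t + 1))) ∧
      ∀ j, u (j * (m * s)) ∈ MulAction.orbit G (u 0) := by
  obtain ⟨g, hg⟩ := hend
  change g • a 0 = a (m * s) at hg
  refine ⟨fun t => g ^ (t / (m * s)) • a (t % (m * s)), ?_, ?_, ?_⟩
  · simp
  · intro t
    have hlt := Nat.mod_lt t hm
    have hSt : St t = St (t % (m * s)) := by
      conv_lhs => rw [← Nat.div_add_mod' t (m * s)]
      rw [← Nat.mul_assoc]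
      exact apply_mul_add hs _ _
    rw [hSt]
    rcases Nat.lt_or_ge (t % (m * s) + 1) (m * s) with h | h
    · have h1 : (t + 1) / (m * s) = t / (m * s) := by
        conv_lhs => rw [← Nat.div_add_mod' t (m * s), Nat.add_assoc]
        rw [Nat.mul_comm, Nat.mul_add_div hm, Nat.div_eq_of_lt h, Nat.add_zero]
      have h2 : (t + 1) % (m * s) = t % (m * s) + 1 := by
        conv_lhs => rw [← Nat.div_add_mod' t (m * s), Nat.add_assoc]
        rw [Nat.mul_comm, Nat.mul_add_mod, Nat.mod_eq_of_lt h]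
      simp only [h1, h2]
      exact hinv _ _ _ _ (ha _ hlt)
    · have h0 : t % (m * s) + 1 = m * s := by omega
      have ht : t + 1 = m * s * (t / (m * s) + 1) := by
        conv_lhs => rw [← Nat.div_add_mod t (m * s), Nat.add_assoc, h0]
        ring
      have h1 : (t + 1) / (m * s) = t / (m * s) + 1 := by
        rw [ht, Nat.mul_div_cancel_left _ hm]
      have h2 : (t + 1) % (m * s) = 0 := by
        rw [ht, Nat.mul_mod_right]
      simp only [h1, h2]
      have h3 := ha _ hlt
      rw [h0] at h3
      rw [pow_succ, mul_smul, hg]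
      exact hinv _ _ _ _ h3
  · intro j
    refine ⟨g ^ j, ?_⟩
    simp [Nat.mul_div_cancel _ hm]

/-- Arbitrarily long paths through a periodic system contain a path that returns to its orbit. -/
theorem IsOligomorphic.exists_periodic (hG : IsOligomorphic G) {s : ℕ} (hs0 : 0 < s)
    (hs : ∀ t, St (t + s) = St t) (hinv : ∀ t (g : G) a b, St t a b → St t (g • a) (g • b))
    {D : ℕ → Set (Fin k → A)} (hD : ∀ t, D (t + s) = D t)
    (hseg : ∀ N, ∃ a : ℕ → Fin k → A, (∀ t < N, St t (a t) (a (t + 1))) ∧ ∀ t ≤ N, a t ∈ D t) :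
    ∃ m, 0 < m ∧ ∃ u : ℕ → Fin k → A, u 0 ∈ D 0 ∧ (∀ t, St t (u t) (u (t + 1))) ∧
      ∀ j, u (j * (m * s)) ∈ MulAction.orbit G (u 0) := by
  have := hG k
  set c := Nat.card (MulAction.orbitRel.Quotient G (Fin k → A)) with hc
  obtain ⟨a, ha, haD⟩ := hseg (c * s)
  obtain ⟨i, j, hij, h⟩ : ∃ i j : Fin (c + 1), i < j ∧
      a (j * s) ∈ MulAction.orbit G (a (i * s)) := by
    set f : Fin (c + 1) → MulAction.orbitRel.Quotient G (Fin k → A) :=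
      fun i => Quotient.mk _ (a (i * s)) with hf
    have hninj : ¬Function.Injective f := by
      intro h
      have := Nat.card_le_card_of_injective f h
      rw [Nat.card_fin] at this
      omega
    rw [Function.Injective] at hninj
    push Not at hninj
    obtain ⟨i, j, h, hne⟩ := hninj
    have h' : MulAction.orbitRel G (Fin k → A) (a (i * s)) (a (j * s)) := Quotient.exact h
    rcases lt_or_gt_of_ne hne with hlt | hlt
    · exact ⟨i, j, hlt, (MulAction.orbitRel_apply.1 (Setoid.symm' _ h'))⟩
    · exact ⟨j, i, hlt, (MulAction.orbitRel_apply.1 h')⟩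
  have hij' : (i : ℕ) < j := hij
  have hjs : i * s + (j - i) * s = j * s := by
    rw [← Nat.add_mul, Nat.add_sub_cancel' hij'.le]
  have hjc : (j : ℕ) * s ≤ c * s := Nat.mul_le_mul_right s (Nat.lt_succ_iff.1 j.2)
  obtain ⟨u, hu0, hu, hu'⟩ := exists_periodic_of_segment (G := G) (m := j - i) hs hinv
    (Nat.mul_pos (by omega) hs0) (a := fun t => a (i * s + t))
    (fun t ht => by
      have := ha (i * s + t) (by omega)
      rwa [apply_mul_add hs] at this)
    (by simpa only [hjs, Nat.add_zero] using h)
  refine ⟨j - i, by omega, u, ?_, hu, hu'⟩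
  rw [hu0, ← apply_mul_add hD i 0]
  exact haD _ (by omega)

theorem exists_forward_segment {C : ℕ → Set (Fin k → A)} (h0 : (C 0).Nonempty)
    (h : ∀ t, ∀ a ∈ C t, ∃ b ∈ C (t + 1), St t a b) (N : ℕ) :
    ∃ a : ℕ → Fin k → A, (∀ t < N, St t (a t) (a (t + 1))) ∧ ∀ t ≤ N, a t ∈ C t := by
  induction N with
  | zero =>
    obtain ⟨x, hx⟩ := h0
    refine ⟨fun _ => x, fun t ht => absurd ht (by omega), fun t ht => ?_⟩
    obtain rfl : t = 0 := by omega
    exact hx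
  | succ N ih =>
    obtain ⟨a, ha, haC⟩ := ih
    obtain ⟨b, hb, hab⟩ := h N (a N) (haC N le_rfl)
    refine ⟨fun t => if t ≤ N then a t else b, fun t ht => ?_, fun t ht => ?_⟩
    · rcases Nat.lt_or_ge t N with h1 | h1
      · simpa [h1.le, Nat.succ_le_of_lt h1] using ha t h1
      · obtain rfl : t = N := by omega
        simpa using hab
    · rcases Nat.lt_or_ge N t with h1 | h1
      · obtain rfl : t = N + 1 := by omega
        simpa using hb
      · simpa [h1] using haC t h1

/-- Only predecessors are available, so the segment grows from its end. Finite segments are enough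
for the pigeonhole argument on orbits. -/
theorem exists_backward_segment {D : ℕ → Set (Fin k → A)} (h0 : ∀ t, (D t).Nonempty)
    (h : ∀ t, ∀ b ∈ D (t + 1), ∃ a ∈ D t, St t a b) (N : ℕ) :
    ∃ a : ℕ → Fin k → A, (∀ t < N, St t (a t) (a (t + 1))) ∧ ∀ t ≤ N, a t ∈ D t := by
  suffices H : ∀ n ≤ N, ∃ a : ℕ → Fin k → A,
      (∀ t < N, N ≤ t + n → St t (a t) (a (t + 1))) ∧ ∀ t ≤ N, N ≤ t + n → a t ∈ D t by
    obtain ⟨a, h1, h2⟩ := H N le_rfl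
    exact ⟨a, fun t ht => h1 t ht (by omega), fun t ht => h2 t ht (by omega)⟩
  intro n
  induction n with
  | zero =>
    obtain ⟨x, hx⟩ := h0 N
    refine fun _ => ⟨fun _ => x, fun t ht => absurd ht ∘ by omega, fun t ht ht' => ?_⟩
    obtain rfl : t = N := by omega
    exact hx
  | succ n ih =>
    intro hn
    obtain ⟨a, ha, haD⟩ := ih (by omega)
    have hN : N - (n + 1) + 1 = N - n := by omega
    obtain ⟨b, hb, hab⟩ := h (N - (n + 1)) (a (N - n)) (by
      rw [hN]
      exact haD _ (by omega) (by omega))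
    refine ⟨fun t => if t = N - (n + 1) then b else a t, fun t ht ht' => ?_, fun t ht ht' => ?_⟩
    · rcases eq_or_ne t (N - (n + 1)) with h1 | h1
      · subst h1
        simpa [hN, show N - n ≠ N - (n + 1) by omega] using hab
      · simp only
        rw [if_neg h1, if_neg (by omega)]
        exact ha t ht (by omega)
    · rcases eq_or_ne t (N - (n + 1)) with h1 | h1
      · subst h1
        simpa using hb
      · simp only
        rw [if_neg h1]
        exact haD t ht (by omega)

end Sequences

/-! ### Changing single entries of a tuple -/

/-- Changing one entry of an injective `k`-tuple reaches every orbit of injective `k`-tuples. -/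
theorem exists_update_mem_orbit {A : Type u} {G : Subgroup (Equiv.Perm A)} {k : ℕ}
    (hG : MulAction.IsMultiplyPretransitive G A (k - 1)) {a e : Fin k → A}
    (ha : Function.Injective a) (he : Function.Injective e) (i : Fin k) :
    ∃ x, Function.update a i x ∈ MulAction.orbit G e := by
  obtain ⟨eqv⟩ : Nonempty (Fin (k - 1) ≃ {j : Fin k // j ≠ i}) := by
    refine ⟨(Fintype.equivFinOfCardEq ?_).symm⟩
    rw [Fintype.card_subtype_compl, Fintype.card_fin, Fintype.card_subtype_eq]
  obtain ⟨g, hg⟩ := hG.exists_smul_eq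
    (⟨fun j => e (eqv j), fun x y h => eqv.injective (Subtype.ext (he h))⟩ : Fin (k - 1) ↪ A)
    (⟨fun j => a (eqv j), fun x y h => eqv.injective (Subtype.ext (ha h))⟩ : Fin (k - 1) ↪ A)
  refine ⟨g.1 (e i), g, ?_⟩
  funext j
  rcases eq_or_ne j i with rfl | hj
  · rw [Function.update_self]
    rfl
  · obtain ⟨l, hl⟩ := eqv.surjective ⟨j, hj⟩
    have := DFunLike.congr_fun hg l
    rw [Function.update_of_ne hj]
    change g.1 (e (eqv l)) = a (eqv l) at this
    rw [hl] at this
    exact this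

/-- Any value of the entry `q` can be reached from any other by alternately changing the entries
`p` and `q` inside a fixed orbit. -/
theorem exists_zigzag {A : Type u} [Nonempty A] {G : Subgroup (Equiv.Perm A)} {k : ℕ}
    (hG : IsKHomogeneous G k) (hB : HasFiniteDuality (canonicalLanguage G k) A)
    {p q : Fin k} (hpq : p ≠ q) {a e : Fin k → A} (he : Function.Injective e)
    {x₀ y : A} (hx₀ : Function.update a q x₀ ∈ MulAction.orbit G e)
    (hy : Function.update a p y ∈ MulAction.orbit G e) :
    ∃ (N : ℕ) (x d : ℕ → A), x 0 = x₀ ∧ x N = a q ∧ ∀ j < N,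
      Function.update (Function.update a q (x j)) p (d j) ∈ MulAction.orbit G e ∧
      Function.update (Function.update a q (x (j + 1))) p (d j) ∈ MulAction.orbit G e := by
  obtain ⟨T, hT⟩ := exists_smul_chain hG hB
  -- Even tuples are `e` without entry `p`; odd ones carry `e p` in place of `e q`. Two neighbours
  -- share all positions but `q` and together contain all of `e`, so any translate of such a pair
  -- spells a tuple in the orbit of `e`.
  set u : ℕ → {i : Fin k // i ≠ p} → A := fun t i =>
    if t % 2 = 0 then e i else if i.1 = q then e p else e i with hu
  have u_even : ∀ t, t % 2 = 0 → ∀ i, u t i = e i := fun t ht i => by simp [hu, ht]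
  have u_ne : ∀ t i, i.1 ≠ q → u t i = e i := fun t i hi => by simp [hu, hi]
  have u_odd : ∀ t, t % 2 = 1 → ∀ h, u t ⟨q, h⟩ = e p := fun t ht h => by simp [hu, ht]
  have lkiff : ∀ t i i', u t i = u (t + 1) i' ↔ i = i' ∧ i.1 ≠ q := by
    have key : ∀ t t' i i', t % 2 = 0 → t' % 2 = 1 → (u t i = u t' i' ↔ i = i' ∧ i.1 ≠ q) := by
      intro t t' i i' ht ht'
      rw [u_even t ht]
      by_cases hi' : i'.1 = q
      · obtain ⟨i', h⟩ := i'
        simp only at hi'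
        subst hi'
        rw [u_odd t' ht']
        constructor
        · intro h
          exact absurd (he h) i.2
        · rintro ⟨rfl, h⟩
          exact absurd rfl h
      · rw [u_ne t' i' hi']
        constructor
        · intro h
          have := Subtype.ext (he h)
          exact ⟨this, this ▸ hi'⟩
        · rintro ⟨rfl, -⟩
          rfl
    intro t i i'
    rcases Nat.mod_two_eq_zero_or_one t with ht | ht
    · exact key t (t + 1) i i' ht (by omega)
    · rw [eq_comm, key (t + 1) t i' i (by omega) ht]
      constructor
      · rintro ⟨rfl, h⟩
        exact ⟨rfl, h⟩
      · rintro ⟨rfl, h⟩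
        exact ⟨rfl, h⟩
  have uinj : ∀ t, Function.Injective (u t) := by
    intro t i i' h
    rcases Nat.mod_two_eq_zero_or_one t with ht | ht
    · rw [u_even t ht, u_even t ht] at h
      exact Subtype.ext (he h)
    · obtain ⟨i, hi⟩ := i
      obtain ⟨i', hi'⟩ := i'
      by_cases h1 : i = q <;> by_cases h2 : i' = q
      · exact Subtype.ext (h1.trans h2.symm)
      · subst h1
        rw [u_odd t ht, u_ne t _ h2] at h
        exact absurd (he h).symm hi'
      · subst h2
        rw [u_odd t ht, u_ne t _ h1] at h
        exact absurd (he h) hi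
      · rw [u_ne t _ h1, u_ne t _ h2] at h
        exact Subtype.ext (he h)
  have hcov : ∀ t, k ≤ (Set.range (u t) ∪ Set.range (u (t + 1))).ncard := by
    have key : ∀ t t', t % 2 = 0 → t' % 2 = 1 →
        k ≤ (Set.range (u t) ∪ Set.range (u t')).ncard := by
      intro t t' ht ht'
      have hsub : Set.range e ⊆ Set.range (u t) ∪ Set.range (u t') := by
        rintro _ ⟨i, rfl⟩
        by_cases hi : i = p
        · subst hi
          exact Or.inr ⟨⟨q, hpq.symm⟩, u_odd t' ht' _⟩
        · exact Or.inl ⟨⟨i, hi⟩, u_even t ht _⟩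
      have h1 := Set.ncard_le_ncard hsub (Set.toFinite _)
      rwa [← Set.image_univ, Set.ncard_image_of_injective _ he, Set.ncard_univ, Nat.card_fin] at h1
    intro t
    rcases Nat.mod_two_eq_zero_or_one t with ht | ht
    · exact key t (t + 1) ht (by omega)
    · rw [Set.union_comm]
      exact key (t + 1) t (by omega) ht
  have hScard : ({i : {i : Fin k // i ≠ p} | i.1 ≠ q} : Set _).ncard < k := by
    have h1 := Set.ncard_le_ncard (Set.subset_univ {i : {i : Fin k // i ≠ p} | i.1 ≠ q})
      (Set.toFinite _)
    rw [Set.ncard_univ, Nat.card_eq_fintype_card, Fintype.card_subtype_compl, Fintype.card_fin,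
      Fintype.card_subtype_eq] at h1
    have := p.pos
    omega
  obtain ⟨g₁, hg₁⟩ := hx₀
  obtain ⟨g₂, hg₂⟩ := hy
  change g₁ • e = _ at hg₁
  change g₂ • e = _ at hg₂
  obtain ⟨w, hw0, hwT, hw⟩ := hT u uinj hcov 2 two_pos {i | i.1 ≠ q} hScard (by
      intro j i i'
      simp only [Traces, lkiff]
      constructor
      · rintro ⟨_, ⟨_, rfl, rfl, -⟩, rfl, h⟩
        exact ⟨rfl, h⟩
      · rintro ⟨rfl, h⟩
        exact ⟨i, ⟨i, rfl, rfl, h⟩, rfl, h⟩) T le_rfl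
    (fun i => Function.update a q x₀ i) ⟨g₁, by
      funext i
      change g₁.1 (u 0 i) = _
      rw [u_even 0 rfl, ← hg₁]
      rfl⟩ (fun i => a i) ⟨g₂, by
      funext i
      change g₂.1 (u (T * 2) i) = _
      rw [u_even _ (Nat.mul_mod_left _ _), ← Function.update_of_ne i.2 y a, ← hg₂]
      rfl⟩ (by
      intro i hi
      exact Function.update_of_ne hi _ _)
  have hconst : ∀ t ≤ T * 2, ∀ i, i.1 ≠ q → w t i = a i := by
    intro t
    induction t with
    | zero =>
      intro _ i hi
      rw [hw0]
      exact Function.update_of_ne hi _ _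
    | succ t ih =>
      intro ht i hi
      obtain ⟨g, h1, h2⟩ := hw t ht
      rw [← ih (by omega) i hi, h1, h2]
      exact congrArg g.1 ((lkiff t i i).2 ⟨rfl, hi⟩).symm
  have hmem : ∀ t t', t % 2 = 0 → t' % 2 = 1 → t ≤ T * 2 → ∀ g : G, w t = g • u t →
      w t' = g • u t' → Function.update (Function.update a q (w t ⟨q, hpq.symm⟩)) p
        (w t' ⟨q, hpq.symm⟩) ∈ MulAction.orbit G e := by
    intro t t' ht ht' htT g h1 h2
    refine ⟨g, ?_⟩
    funext i
    change g.1 (e i) = _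
    by_cases hi : i = p
    · subst hi
      rw [Function.update_self, h2, smul_tuple_apply, u_odd t' ht']
    · rw [Function.update_of_ne hi]
      by_cases hi' : i = q
      · subst hi'
        rw [Function.update_self, h1, smul_tuple_apply, u_even t ht]
      · rw [Function.update_of_ne hi', ← hconst t htT ⟨i, hi⟩ hi', h1, smul_tuple_apply,
          u_even t ht]
  -- Even times give the values of entry `q`, odd times those of entry `p`.
  refine ⟨T, fun j => w (j * 2) ⟨q, hpq.symm⟩, fun j => w (j * 2 + 1) ⟨q, hpq.symm⟩, ?_, ?_, ?_⟩
  · simp [hw0]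
  · simp [hwT]
  · intro j hj
    obtain ⟨g, h1, h2⟩ := hw (j * 2) (by omega)
    obtain ⟨g', h1', h2'⟩ := hw (j * 2 + 1) (by omega)
    refine ⟨hmem _ _ (by omega) (by omega) (by omega) g h1 h2, ?_⟩
    exact hmem ((j + 1) * 2) _ (by omega) (by omega) (by omega) g' (by
      rw [show (j + 1) * 2 = j * 2 + 1 + 1 by ring]; exact h2') h1'

/-! ### Near-unanimity against a cycle of implications -/

/-- A periodic system of injective implications is incompatible with near-unanimity operations. -/
theorem false_of_periodic_implications {A : Type u} [Nonempty A] {G : Subgroup (Equiv.Perm A)}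
    {k : ℕ} (hk : 2 ≤ k) (hG : IsNeoliberal G k)
    (hB : HasFiniteDuality (canonicalLanguage G k) A) {s : ℕ} (hs0 : 0 < s)
    {St : ℕ → (Fin k → A) → (Fin k → A) → Prop} {lk : ℕ → Fin k → Fin k → Prop}
    (hSt : ∀ t, St (t + s) = St t) (hlk : ∀ t, lk (t + s) = lk t)
    (hinv : ∀ t (g : G) a b, St t a b → St t (g • a) (g • b))
    (hinj : ∀ t a b, St t a b →
      Function.Injective a ∧ Function.Injective b ∧ ∀ p q, a p = b q ↔ lk t p q)
    (hnt : ∀ t, ∃ q, ∀ p, ¬lk t p q) {C D : ℕ → Set (Fin k → A)}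
    (hC : ∀ t, C (t + s) = C t) (hD : ∀ t, D (t + s) = D t)
    (hCinv : ∀ (g : G), ∀ a ∈ C 0, g • a ∈ C 0) (hdisj : ∀ a ∈ D 0, a ∉ C 0)
    (hC0 : (C 0).Nonempty) (hD0 : ∀ t, (D t).Nonempty)
    (hfwd : ∀ t, ∀ a ∈ C t, ∃ b, St t a b)
    (himp : ∀ t a b, St t a b → a ∈ C t → b ∈ C (t + 1))
    (hbwd : ∀ t, ∀ b ∈ D (t + 1), ∃ a ∈ D t, St t a b)
    {n : ℕ} (hn : 0 < n) (F : Finset (Fin n → A) → (Fin n → A) → A)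
    (hF : ∀ t (α β : Fin k → Fin n → A), (∀ r, St t (fun i => α i r) (fun i => β i r)) →
      ∀ᶠ X in Filter.atTop, St t (fun i => F X (α i)) (fun i => F X (β i)))
    (hNU : ∀ (c : Fin n → A) (a : A) (i : Fin n), (∀ r, r ≠ i → c r = a) →
      ∀ᶠ X in Filter.atTop, F X c = a) : False := by
  classical
  obtain ⟨m₁, hm₁, uO, hO0, hO, hO'⟩ := hG.oligomorphic.exists_periodic hs0 hSt hinv hC
    (exists_forward_segment hC0 fun t a ha => by
      obtain ⟨b, hb⟩ := hfwd t a ha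
      exact ⟨b, himp t a b hb ha, hb⟩)
  obtain ⟨m₂, hm₂, uP, hP0, hP, hP'⟩ := hG.oligomorphic.exists_periodic hs0 hSt hinv hD
    (exists_backward_segment hD0 hbwd)
  have hl : ∀ t p p' q, lk t p q → lk t p' q → p = p' := by
    intro t p p' q h h'
    obtain ⟨h1, -, h2⟩ := hinj t _ _ (hO t)
    exact h1 (((h2 _ _).2 h).trans ((h2 _ _).2 h').symm)
  have hr : ∀ t p q q', lk t p q → lk t p q' → q = q' := by
    intro t p q q' h h'
    obtain ⟨-, h1, h2⟩ := hinj t _ _ (hO t)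
    exact h1 (((h2 _ _).2 h).symm.trans ((h2 _ _).2 h'))
  -- The product `m₁ * m₂ * s` is a common multiple of the return times of both paths and of the
  -- period of the system.
  obtain ⟨e, he, S, hS⟩ := exists_traces_partial_id hl hr (s := m₁ * m₂ * s) (by
    intro t
    rw [Nat.add_comm]
    exact apply_mul_add hlk _ _)
  set M := e * (m₁ * m₂ * s) with hM
  have hMpos : 0 < M := by positivity
  -- A position that is unlinked in the last step of a period cannot be the end of a trace over that
  -- period.
  obtain ⟨p, hp⟩ : ∃ p, p ∉ S := by
    obtain ⟨q, hq⟩ := hnt (M - 1)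
    refine ⟨q, fun hqS => ?_⟩
    have h1 := (hS 0 q q).2 ⟨rfl, hqS⟩
    rw [Nat.zero_mul, show M = (M - 1) + 1 by omega] at h1
    obtain ⟨p', -, h2⟩ := h1
    rw [Nat.zero_add] at h2
    exact hq p' h2
  have hSk : S.ncard < k := by
    have h1 : S ⊂ Set.univ := Set.ssubset_univ_iff.2 fun h => hp (h ▸ Set.mem_univ p)
    have h2 := Set.ncard_lt_ncard h1 (Set.toFinite _)
    rwa [Set.ncard_univ, Nat.card_fin] at h2
  obtain ⟨T, hT⟩ := exists_smul_chain hG.homogeneous hB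
  have chain : ∀ u : ℕ → Fin k → A, (∀ t, St t (u t) (u (t + 1))) →
      (∀ j, u (j * M) ∈ MulAction.orbit G (u 0)) →
      ∀ a ∈ MulAction.orbit G (u 0), ∀ b ∈ MulAction.orbit G (u 0), (∀ i, i ≠ p → a i = b i) →
      ∃ w : ℕ → Fin k → A, w 0 = a ∧ w (T * M) = b ∧ ∀ t < T * M, St t (w t) (w (t + 1)) := by
    intro u hu hu' a ha b hb hab
    have hlku : (fun t p q => u t p = u (t + 1) q) = lk := by
      funext t p q
      exact propext ((hinj t _ _ (hu t)).2.2 p q)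
    obtain ⟨w, hw0, hwT, hw⟩ := hT u (fun t => (hinj t _ _ (hu t)).1) (fun t => by
        refine le_trans ?_ (Set.ncard_le_ncard Set.subset_union_left (Set.toFinite _))
        rw [← Set.image_univ, Set.ncard_image_of_injective _ (hinj t _ _ (hu t)).1,
          Set.ncard_univ, Nat.card_fin]) M hMpos S hSk (by rw [hlku]; exact hS) T le_rfl a ha b
      (by rw [MulAction.orbit_eq_iff.2 (hu' T)]; exact hb)
      (fun i hi => hab i fun h => hp (h ▸ hi))
    refine ⟨w, hw0, hwT, fun t ht => ?_⟩
    obtain ⟨g, h1, h2⟩ := hw t ht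
    rw [h1, h2]
    exact hinv t g _ _ (hu t)
  have chainO := chain uO hO fun j => by
    rw [show j * M = j * e * m₂ * (m₁ * s) by rw [hM]; ring]
    exact hO' _
  have chainP := chain uP hP fun j => by
    rw [show j * M = j * e * m₁ * (m₂ * s) by rw [hM]; ring]
    exact hP' _
  set Q : (Fin k → Fin n → A) → Prop := fun α =>
    ∀ᶠ X in Filter.atTop, (fun i => F X (α i)) ∈ C 0 with hQ
  have hCM : C (T * M) = C 0 := by
    rw [show T * M = (T * e * m₁ * m₂) * s + 0 by rw [hM]; ring]
    exact apply_mul_add hC _ _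
  -- transfer along chains
  have move : ∀ α β : Fin k → Fin n → A,
      (∀ r, ((fun i => α i r) ∈ MulAction.orbit G (uO 0) ∧ (fun i => β i r) ∈ MulAction.orbit G (uO 0)) ∨
        ((fun i => α i r) ∈ MulAction.orbit G (uP 0) ∧ (fun i => β i r) ∈ MulAction.orbit G (uP 0))) →
      (∀ i, i ≠ p → α i = β i) → Q α → Q β := by
    intro α β hαβ hoff hα
    have hex : ∀ r, ∃ w : ℕ → Fin k → A, w 0 = (fun i => α i r) ∧ w (T * M) = (fun i => β i r) ∧
        ∀ t < T * M, St t (w t) (w (t + 1)) := by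
      intro r
      rcases hαβ r with ⟨h1, h2⟩ | ⟨h1, h2⟩
      · exact chainO _ h1 _ h2 fun i hi => congrFun (hoff i hi) r
      · exact chainP _ h1 _ h2 fun i hi => congrFun (hoff i hi) r
    choose w hw0 hwT hw using hex
    have hind : ∀ t ≤ T * M,
        ∀ᶠ X in Filter.atTop, (fun i => F X (fun r => w r t i)) ∈ C t := by
      intro t
      induction t with
      | zero =>
        intro _
        have : (fun i r => w r 0 i) = α := by
          funext i r
          exact congrFun (hw0 r) i
        refine hα.mono fun X hX => ?_
        rw [← this] at hX
        exact hX
      | succ t ih =>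
        intro ht
        filter_upwards [ih (by omega), hF t (fun i r => w r t i) (fun i r => w r (t + 1) i)
          fun r => hw r t ht] with X h1 h2
        exact himp t _ _ h2 h1
    have hβ : (fun i r => w r (T * M) i) = β := by
      funext i r
      exact congrFun (hwT r) i
    refine (hind _ le_rfl).mono fun X hX => ?_
    rw [hCM] at hX
    rw [← hβ]
    exact hX
  obtain ⟨q, hqp⟩ : ∃ q : Fin k, q ≠ p := by
    have : Nontrivial (Fin k) := Fin.nontrivial_iff_two_le.2 hk
    exact exists_ne p
  set a := uO 0 with ha
  have hainj : Function.Injective a := (hinj 0 _ _ (hO 0)).1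
  have heinj : Function.Injective (uP 0) := (hinj 0 _ _ (hP 0)).1
  obtain ⟨y, hy⟩ := exists_update_mem_orbit hG.transitive hainj heinj p
  obtain ⟨x₀, hx₀⟩ := exists_update_mem_orbit hG.transitive hainj heinj q
  obtain ⟨N, x, d, hx0, hxN, hxd⟩ := exists_zigzag hG.homogeneous hB hqp.symm heinj hx₀ hy
  -- Rows before `j` are already in the second orbit, row `j` is being rewritten, and later rows are
  -- still `a`.
  set row : ℕ → A → A → Fin n → Fin k → A := fun j x d r =>
    if r.1 < j then Function.update a p y
    else if r.1 = j then Function.update (Function.update a q x) p d else a with hrow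
  set Θ : ℕ → A → A → Fin k → Fin n → A := fun j x d i r => row j x d r i with hΘ
  -- Outside row `j`, column `q` is constantly `a q`, so near-unanimity returns `a q` whatever row
  -- `j` holds there. The intermediate row need not lie in any particular orbit.
  have nu : ∀ j < n, ∀ x x' d, Q (Θ j x d) → Q (Θ j x' d) := by
    intro j hj x x' d hQx
    have hcol : ∀ x'' : A, ∀ᶠ X in Filter.atTop, F X (Θ j x'' d q) = a q := by
      intro x''
      refine hNU _ _ ⟨j, hj⟩ fun r hr => ?_
      have hr' : r.1 ≠ j := fun h => hr (Fin.ext h)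
      simp only [hΘ, hrow, hr', if_false]
      split_ifs
      · exact Function.update_of_ne hqp _ _
      · rfl
    have hsame : ∀ i, i ≠ q → Θ j x d i = Θ j x' d i := by
      intro i hi
      funext r
      simp only [hΘ, hrow]
      split_ifs
      · rfl
      · by_cases hip : i = p
        · subst hip
          rw [Function.update_self, Function.update_self]
        · rw [Function.update_of_ne hip, Function.update_of_ne hip, Function.update_of_ne hi,
            Function.update_of_ne hi]
      · rfl
    filter_upwards [hQx, hcol x, hcol x'] with X h1 h2 h3
    convert h1 using 1
    funext i
    by_cases hi : i = q
    · subst hi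
      rw [h2, h3]
    · rw [hsame i hi]
  have mv : ∀ j x d d', Function.update (Function.update a q x) p d ∈ MulAction.orbit G (uP 0) →
      Function.update (Function.update a q x) p d' ∈ MulAction.orbit G (uP 0) →
      Q (Θ j x d) → Q (Θ j x d') := by
    intro j x d d' h h'
    refine move _ _ (fun r => ?_) (fun i hi => ?_)
    · change (row j x d r ∈ _ ∧ row j x d' r ∈ _) ∨ (row j x d r ∈ _ ∧ row j x d' r ∈ _)
      simp only [hrow]
      split_ifs
      · exact Or.inr ⟨hy, hy⟩
      · exact Or.inr ⟨h, h'⟩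
      · exact Or.inl ⟨MulAction.mem_orbit_self _, MulAction.mem_orbit_self _⟩
    · funext r
      simp only [hΘ, hrow]
      split_ifs
      · rfl
      · rw [Function.update_of_ne hi, Function.update_of_ne hi]
      · rfl
  have haq : ∀ x, Function.update (Function.update a q x) p (a p) = Function.update a q x := by
    intro x
    rw [Function.update_eq_self_iff, Function.update_of_ne hqp.symm]
  -- Entry `q` first becomes `x₀`, which puts row `j` into the orbit of `uP 0`. Along the zigzag,
  -- entry `q` changes by `nu` and entry `p` by `mv`, until `q` holds `a q` again and `p` holds `y`.
  have step : ∀ j < n, Q (Θ j (a q) (a p)) → Q (Θ j (a q) y) := by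
    intro j hj h0
    have hz : ∀ i ≤ N, ∀ d', Function.update (Function.update a q (x i)) p d' ∈
        MulAction.orbit G (uP 0) → Q (Θ j (x i) d') := by
      intro i
      induction i with
      | zero =>
        intro _ d' hd'
        rw [hx0] at hd' ⊢
        exact mv j x₀ (a p) d' (by rwa [haq]) hd' (nu j hj _ _ _ h0)
      | succ i ih =>
        intro hi d' hd'
        obtain ⟨h1, h2⟩ := hxd i hi
        exact mv j _ (d i) d' h2 hd' (nu j hj _ _ _ (ih (by omega) _ h1))
    have := hz N le_rfl y (by rwa [hxN, Function.update_eq_self])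
    rwa [hxN] at this
  have all : ∀ j ≤ n, Q (Θ j (a q) (a p)) := by
    intro j
    induction j with
    | zero =>
      intro _
      have : ∀ᶠ X in Filter.atTop, ∀ i, F X (Θ 0 (a q) (a p) i) = a i := by
        rw [Filter.eventually_all]
        intro i
        refine hNU _ _ ⟨0, hn⟩ fun r _ => ?_
        simp only [hΘ, hrow, Nat.not_lt_zero, if_false, Function.update_eq_self, ite_self]
      filter_upwards [this] with X hX
      rw [funext hX]
      exact hO0
    | succ j ih =>
      intro hj
      have h1 := step j hj (ih (by omega))
      have h2 : Θ (j + 1) (a q) (a p) = Θ j (a q) y := by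
        funext i r
        simp only [hΘ, hrow, Function.update_eq_self, ite_self]
        rcases lt_trichotomy r.1 j with h | h | h
        · rw [if_pos (by omega), if_pos h]
        · rw [if_pos (by omega), if_neg (by omega), if_pos h]
        · rw [if_neg (by omega), if_neg (by omega), if_neg (by omega)]
      rwa [h2]
  have hlast : ∀ᶠ X in Filter.atTop, ∀ i, F X (Θ n (a q) (a p) i) = Function.update a p y i := by
    rw [Filter.eventually_all]
    intro i
    refine hNU _ _ ⟨0, hn⟩ fun r _ => ?_
    simp only [hΘ, hrow, r.2, if_true]
  obtain ⟨X, h1, h2⟩ := ((all n le_rfl).and hlast).exists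
  rw [funext h2] at h1
  obtain ⟨g, hg⟩ := hy
  refine hdisj _ hP0 ?_
  have h3 := hCinv g⁻¹ _ h1
  rw [← hg] at h3
  change g⁻¹ • g • uP 0 ∈ C 0 at h3
  rwa [inv_smul_smul] at h3

/-! ### Invariance under `G`, and unrolling a cycle -/

/-- Elements of `G` are automorphisms of the canonical structure. -/
def canonicalEquiv {A : Type u} {G : Subgroup (Equiv.Perm A)} (k : ℕ) (g : G) :
    A ≃[canonicalLanguage G k] A where
  toEquiv := g.1
  map_fun' := fun f _ => nomatch f
  map_rel' := by
    rintro n ⟨O, -, a, -, rfl⟩ x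
    change g • x ∈ MulAction.orbit G a ↔ x ∈ MulAction.orbit G a
    rw [← MulAction.orbit_eq_iff, MulAction.orbit_smul, MulAction.orbit_eq_iff]

/-- Formulas over a first-order expansion of the canonical structure define `G`-invariant
relations. -/
theorem IsFirstOrderExpansion.smul_mem_sols {A : Type u} {G : Subgroup (Equiv.Perm A)} {k : ℕ}
    {L : FirstOrder.Language.{v, w}} [L.IsRelational] [L.Structure A]
    (hA : IsFirstOrderExpansion (canonicalLanguage G k) L A) (g : G) {V : Type} (φ : L.Formula V)
    {f : V → A} (hf : f ∈ sols A φ) : g • f ∈ sols A φ := by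
  set gL : A ≃[L] A :=
    { toEquiv := g.1
      map_fun' := fun f _ => isEmptyElim f
      map_rel' := by
        intro n R x
        obtain ⟨ψ, hψ⟩ := Set.empty_definable_iff.1 (hA.2 n R)
        have h1 : ∀ z : Fin n → A, Structure.RelMap R z ↔ ψ.Realize z := fun z => by
          change z ∈ {x : Fin n → A | Structure.RelMap R x} ↔ _
          rw [hψ]
          rfl
        rw [h1, h1]
        exact StrongHomClass.realize_formula (canonicalEquiv k g) ψ } with hgL
  exact (StrongHomClass.realize_formula gL φ).2 hf

theorem exists_periodic_of_transGen {α : Type*} {r : α → α → Prop} {x : α}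
    (h : Relation.TransGen r x x) :
    ∃ s, 0 < s ∧ ∃ Q : ℕ → α, ∀ t, r (Q (t % s)) (Q ((t + 1) % s)) := by
  have key : ∀ y, Relation.TransGen r x y → ∃ s, 0 < s ∧ ∃ Q : ℕ → α, Q 0 = x ∧ Q s = y ∧
      ∀ t < s, r (Q t) (Q (t + 1)) := by
    intro y hy
    induction hy with
    | @single b h =>
      refine ⟨1, one_pos, fun t => if t = 0 then x else b, rfl, rfl, fun t ht => ?_⟩
      obtain rfl : t = 0 := by omega
      simpa using h
    | @tail b c _ h ih =>
      obtain ⟨s, hs, Q, h0, hQs, hQ⟩ := ih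
      refine ⟨s + 1, s.succ_pos, fun t => if t ≤ s then Q t else c, by simp [h0], by simp,
        fun t ht => ?_⟩
      rcases Nat.lt_or_ge t s with h1 | h1
      · simpa [h1.le, Nat.succ_le_of_lt h1] using hQ t h1
      · obtain rfl : t = s := by omega
        simpa [hQs] using h
  obtain ⟨s, hs, Q, h0, hQs, hQ⟩ := key x h
  refine ⟨s, hs, Q, fun t => ?_⟩
  have hlt := Nat.mod_lt t hs
  have h1 := hQ _ hlt
  rw [← Nat.mod_add_mod]
  rcases Nat.lt_or_ge (t % s + 1) s with h2 | h2
  · rwa [Nat.mod_eq_of_lt h2]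
  · have h3 : t % s + 1 = s := by omega
    rw [h3] at h1 ⊢
    rw [Nat.mod_self, h0, ← hQs]
    exact h1

theorem IsImplication.finite {L : FirstOrder.Language.{v, w}} {A : Type u} [L.Structure A]
    {V : Type} {k m : ℕ} {φ : L.Formula V} {C : Set (Fin k → A)} {x : Fin k → V}
    {D : Set (Fin m → A)} {y : Fin m → V} (h : IsImplication φ C x D y) : Finite V :=
  Nat.finite_of_card_ne_zero (Nat.ne_zero_of_lt h.left_lt)

/-- Otherwise `x` alone would cover `V`, against `k < Nat.card V`. This fresh variable is the source
of the position that does not survive a period. -/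
theorem IsImplication.exists_notMem_range {L : FirstOrder.Language.{v, w}} {A : Type u}
    [L.Structure A] {V : Type} {k m : ℕ} {φ : L.Formula V} {C : Set (Fin k → A)} {x : Fin k → V}
    {D : Set (Fin m → A)} {y : Fin m → V} (h : IsImplication φ C x D y) :
    ∃ j, y j ∉ Set.range x := by
  by_contra hcon
  push Not at hcon
  have hx : Function.Surjective x := by
    intro z
    have hz : z ∈ Set.range x ∪ Set.range y := h.cover ▸ Set.mem_univ z
    rcases hz with hz | ⟨j, rfl⟩
    · exact hz
    · exact hcon j
  have h1 := Nat.card_le_card_of_surjective x hx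
  rw [Nat.card_fin] at h1
  exact absurd h.left_lt (by omega)

end StrictWidth

theorem theorem1 {A : Type u} (k : ℕ) (hk : 3 ≤ k) (G : Subgroup (Equiv.Perm A))
    (hG : StrictWidth.IsNeoliberal G k)
    (hB : StrictWidth.HasFiniteDuality (StrictWidth.canonicalLanguage G k) A)
    (L : FirstOrder.Language.{v, w}) [L.IsRelational] [L.Structure A]
    (hA : StrictWidth.IsFirstOrderExpansion (StrictWidth.canonicalLanguage G k) L A)
    (hsw : StrictWidth.HasBoundedStrictWidth L A) :
    StrictWidth.IsImplicationallySimpleOnInjective L A k := by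
  intro P hP
  obtain ⟨s, hs, Q, hQ⟩ := StrictWidth.exists_periodic_of_transGen hP
  have : Nonempty A := by
    obtain ⟨a, -⟩ := P.nonempty
    exact ⟨a ⟨0, by omega⟩⟩
  choose _ V φ x y himp hinj hx hy using hQ
  have hV : ∀ t, Finite (V t) := fun t => (himp t).finite
  obtain ⟨n, hn, F, hF, hNU⟩ := hsw.exists_family (κ := Fin s) (fun i => V i) (fun i => φ i)
    (fun i => (himp i).pp)
  have hmod : ∀ t, (t + s) % s = t % s := fun t => Nat.add_mod_right t s
  have hmm : ∀ t, t % s % s = t % s := fun t => Nat.mod_mod t s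
  have hmm' : ∀ t, (t % s + 1) % s = (t + 1) % s := fun t => Nat.mod_add_mod t s 1
  -- With `D` as outer minus inner, the backward condition is the contrapositive of the implication:
  -- a solution whose right end avoids the inner relation also avoids it on the left.
  refine StrictWidth.false_of_periodic_implications (s := s)
    (St := fun t a b => ∃ f ∈ StrictWidth.sols A (φ (t % s)), f ∘ x (t % s) = a ∧ f ∘ y (t % s) = b)
    (lk := fun t p q => x (t % s) p = y (t % s) q)
    (C := fun t => (Q (t % s)).inner) (D := fun t => (Q (t % s)).outer \ (Q (t % s)).inner)
    (by omega) hG hB hs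
    (fun t => congrArg (fun i a b => ∃ f ∈ StrictWidth.sols A (φ i), f ∘ x i = a ∧ f ∘ y i = b)
      (hmod t))
    (fun t => congrArg (fun i p q => x i p = y i q) (hmod t))
    ?_ ?_ ?_ (fun t => by simp only [hmod]) (fun t => by simp only [hmod])
    ?_ (fun a h => h.2) ?_ ?_ ?_ ?_ ?_ hn F ?_ hNU
  · rintro t g _ _ ⟨f, hf, rfl, rfl⟩
    exact ⟨g • f, hA.smul_mem_sols g _ hf, rfl, rfl⟩
  · rintro t _ _ ⟨f, hf, rfl, rfl⟩
    have hfi := hinj _ f hf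
    exact ⟨hfi.comp (himp _).left_injective, hfi.comp (himp _).right_injective,
      fun p q => hfi.eq_iff⟩
  · intro t
    obtain ⟨q, hq⟩ := (himp (t % s)).exists_notMem_range
    exact ⟨q, fun p hp => hq ⟨p, hp⟩⟩
  · intro g a ha
    obtain ⟨ψ, -, hψ⟩ := (Q (0 % s)).inner_pp
    simp only [hψ] at ha ⊢
    exact hA.smul_mem_sols g ψ ha
  · exact (Q _).nonempty
  · exact fun t => Set.nonempty_of_ssubset (Q _).ssubset
  · intro t a ha
    have h1 := (Q _).ssubset.subset ha
    have h2 := hx (t % s)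
    rw [hmm] at h2
    rw [← h2] at h1
    obtain ⟨f, hf, rfl⟩ := h1
    exact ⟨_, f, hf, rfl, rfl⟩
  · rintro t _ _ ⟨f, hf, rfl, rfl⟩ ha
    have h1 := (himp (t % s)).imp f hf
    rw [hmm, hmm'] at h1
    exact h1 ha
  · rintro t b ⟨hb, hb'⟩
    have h2 := hy (t % s)
    rw [hmm'] at h2
    rw [← h2] at hb
    obtain ⟨f, hf, rfl⟩ := hb
    have h1 := (himp (t % s)).imp f hf
    have h3 := hx (t % s)
    rw [hmm, hmm'] at h1
    rw [hmm] at h3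
    refine ⟨f ∘ x (t % s), ⟨?_, fun h => hb' (h1 h)⟩, f, hf, rfl, rfl⟩
    rw [← h3]
    exact ⟨f, hf, rfl⟩
  · intro t α β h
    choose f hf hfx hfy using h
    have h1 := hF ⟨t % s, Nat.mod_lt t hs⟩ (fun z r => f r z) hf
    filter_upwards [h1] with X hX
    refine ⟨_, hX, ?_, ?_⟩
    · funext i
      exact congrArg (F X) (funext fun r => congrFun (hfx r) i)
    · funext i
      exact congrArg (F X) (funext fun r => congrFun (hfy r) i)
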